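/- **Conventions.** Functions on $\mathbb R^2$ are complex valued and $\|\cdot\|_2$ is the $L^2(\mathbb R^2)$ norm. Write $\widehat f(\xi,\eta)=\frac1{2\pi}\int_{\mathbb R^2}e^{-i(x\xi+y\eta)}f(x,y)\,dx\,dy$ for the unitary Fourier transform on $L^2(\mathbb R^2)$ and $g^\vee$ for its inverse. Let $\varphi(\xi,\eta)=\xi^3+\xi\eta^2$ and $W(t)v=(e^{it\varphi}\,\widehat v\,)^\vee$. Let $D_x^a, D_y^a, D^a$ be the Fourier multiplier operators with symbols $|\xi|^a$, $|\eta|^a$, $(\xi^2+\eta^2)^{a/2}$. For $0<\alpha<1$ put $d_\alpha=\pi^{1/2}2^{-\alpha}\,\Gamma(-\alpha/2)/\Gamma((1+\alpha)/2)$ and, with $e_1=(1,0)$, $e_2=(0,1)$ and $j\in\{1,2\}$, $$\Phi_{j,t,\alpha}(f)(\zeta)=\lim_{\varepsilon\to0^+}\frac1{d_\alpha}\int_{|\tau|\ge\varepsilon}\frac{e^{it(\varphi(\zeta+\tau e_j)-\varphi(\zeta))}-1}{|\tau|^{1+\alpha}}\,f(\zeta+\tau e_j)\,d\tau,\qquad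 \zeta\in\mathbb R^2 .$$ **Theorem.** Let $r_1,r_2\in(0,1)$. (i) There is a constant $c>0$, depending only on $r_1,r_2$, such that for all $s\ge 2\max\{r_1,r_2\}$, all $u_0\in H^s(\mathbb R^2)\cap L^2((|x|^{2r_1}+|y|^{2r_2})\,dx\,dy)$ and all $t\in\mathbb R$ the following holds. The functions $\Phi_{1,t,r_1}(\widehat u_0)$ and $\Phi_{2,t,r_2}(\widehat u_0)$ are defined almost everywhere (the truncated integrals converge absolutely and the limit exists) and belong to $L^2(\mathbb R^2)$; for almost every $(x,y)\in\mathbb R^2$ $$|x|^{r_1}W(t)u_0=W(t)(|x|^{r_1}u_0)+W(t)\{\Phi_{1,t,r_1}(\widehat u_0)\}^\vee,\qquad |y|^{r_2}W(t)u_0=W(t)(|y|^{r_2}u_0)+W(t)\{\Phi_{2,t,r_2}(\widehat u_0)\}^\vee;$$ and for $j=1,2$ $$\|\{\Phi_{j,t,r_j}(\widehat u_0)\}^\vee\|_2\le c(1+|t|)\big(\|u_0\|_2+\|D_x^su_0\|_2+\|D_y^su_0\|_2\big).$$ (ii) For every $\beta\in(0,\min\{r_1,r_2\})$ there is a constant $c>0$,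 depending only on $r_1,r_2,\beta$, such that if $s$ and $u_0$ are as in (i) and in addition $D^\beta(|x|^{r_1}u_0),\,D^\beta(|y|^{r_2}u_0)\in L^2(\mathbb R^2)$ and $u_0\in H^{\beta+s}(\mathbb R^2)$, then for all $t\in\mathbb R$ the functions $D^\beta(|x|^{r_1}W(t)u_0)$, $D^\beta(|y|^{r_2}W(t)u_0)$ and $D^\beta\{\Phi_{j,t,r_j}(\widehat u_0)\}^\vee$, $j=1,2$, belong to $L^2(\mathbb R^2)$; almost everywhere $$D^\beta(|x|^{r_1}W(t)u_0)=W(t)\big(D^\beta(|x|^{r_1}u_0)\big)+W(t)\big(D^\beta\{\Phi_{1,t,r_1}(\widehat u_0)\}^\vee\big),$$ $$D^\beta(|y|^{r_2}W(t)u_0)=W(t)\big(D^\beta(|y|^{r_2}u_0)\big)+W(t)\big(D^\beta\{\Phi_{2,t,r_2}(\widehat u_0)\}^\vee\big);$$ and for $j=1,2$ $$\|D^\beta\{\Phi_{j,t,r_j}(\widehat u_0)\}^\vee\|_2\le c(1+|t|)\big(\|u_0\|_2+\|D_x^{\beta+s}u_0\|_2+\|D_y^{\beta+s}u_0\|_2\big).$$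 -/

import Mathlib

open MeasureTheory Filter Topology
open scoped FourierTransform ENNReal SchwartzMap

noncomputable section

namespace ZK

/-- The plane `ℝ²`; for a point `p` the coordinates are `p 0` (that is `x`, or `ξ` on the frequency
side) and `p 1` (that is `y`, or `η`). -/
abbrev Plane : Type := EuclideanSpace ℝ (Fin 2)

open scoped Classical in
/-- The unitary Fourier transform on `L²(ℝ²)` in angular frequency,
`f̂(ξ) = (2π)⁻¹ ∫ e^{-i x·ξ} f(x) dx`, obtained by rescaling Mathlib's Fourier transform on `L²`,
whose kernel is `e^{-2πi x·ξ}`. It is only meaningful for `f ∈ L²`. -/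
def fourier (f : Plane → ℂ) : Plane → ℂ :=
  if hf : MemLp f 2 (volume : Measure Plane) then
    fun ξ => ((2 * Real.pi)⁻¹ : ℝ) * (𝓕 (hf.toLp f) : Lp ℂ 2 (volume : Measure Plane))
      ((2 * Real.pi)⁻¹ • ξ)
  else 0

open scoped Classical in
/-- The inverse of the unitary Fourier transform,
`g^∨(x) = (2π)⁻¹ ∫ e^{i x·ξ} g(ξ) dξ`, on `L²(ℝ²)`. -/
def fourierInv (g : Plane → ℂ) : Plane → ℂ :=
  if hg : MemLp g 2 (volume : Measure Plane) then
    fun x => ((2 * Real.pi)⁻¹ : ℝ) * (𝓕⁻ (hg.toLp g) : Lp ℂ 2 (volume : Measure Plane))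
      ((2 * Real.pi)⁻¹ • x)
  else 0

/-- The Fourier multiplier operator with symbol `m`: `f ↦ (m f̂)^∨`. -/
def multiplier (m : Plane → ℂ) (f : Plane → ℂ) : Plane → ℂ :=
  fourierInv (fun ξ => m ξ * fourier f ξ)

/-- `f ∈ L²` and `(m f̂)^∨ ∈ L²` (the natural domain of the multiplier operator). -/
def MultiplierMemL2 (m : Plane → ℂ) (f : Plane → ℂ) : Prop :=
  MemLp f 2 (volume : Measure Plane) ∧
    MemLp (fun ξ => m ξ * fourier f ξ) 2 (volume : Measure Plane)

/-- The phase `φ(ξ, η) = ξ³ + ξ η²`. -/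
def phase (ξ : Plane) : ℝ := ξ 0 ^ 3 + ξ 0 * ξ 1 ^ 2

/-- The group `W(t) v = (e^{it(ξ³ + ξη²)} v̂)^∨` of the linear Zakharov-Kuznetsov equation. -/
def W (t : ℝ) : (Plane → ℂ) → (Plane → ℂ) :=
  multiplier fun ξ => Complex.exp (Complex.I * ((t * phase ξ : ℝ) : ℂ))

/-- Symbol of the partial homogeneous derivative in the `j`-th variable of order `a`. -/
def dirSymbol (j : Fin 2) (a : ℝ) (ξ : Plane) : ℂ := ((|ξ j| ^ a : ℝ) : ℂ)

/-- Symbol `|(ξ, η)|^a` of the homogeneous derivative `D^a = (-Δ)^{a/2}`. -/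
def homSymbol (a : ℝ) (ξ : Plane) : ℂ := ((‖ξ‖ ^ a : ℝ) : ℂ)

/-- The homogeneous derivative in the first variable, with symbol `|ξ|^a`. -/
def Dx (a : ℝ) : (Plane → ℂ) → (Plane → ℂ) := multiplier (dirSymbol 0 a)

/-- The homogeneous derivative in the second variable, with symbol `|η|^a`. -/
def Dy (a : ℝ) : (Plane → ℂ) → (Plane → ℂ) := multiplier (dirSymbol 1 a)

/-- The homogeneous derivative `D^a`, with symbol `|(ξ, η)|^a`. -/
def D (a : ℝ) : (Plane → ℂ) → (Plane → ℂ) := multiplier (homSymbol a)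

/-- Multiplication by `|x|^r` (`j = 0`) or `|y|^r` (`j = 1`). -/
def weight (j : Fin 2) (r : ℝ) (u : Plane → ℂ) : Plane → ℂ :=
  fun p => ((|p j| ^ r : ℝ) : ℂ) * u p

/-- `u ∈ H^s(ℝ²)` for a function `u ∈ L²`. -/
def MemH (s : ℝ) (u : Plane → ℂ) : Prop :=
  ∃ hu : MemLp u 2 (volume : Measure Plane),
    TemperedDistribution.MemSobolev s 2
      ((hu.toLp u : Lp ℂ 2 (volume : Measure Plane)) : 𝓢'(Plane, ℂ))

/-- The weighted Sobolev space `H^s(ℝ²) ∩ L²((|x|^{2r₁} + |y|^{2r₂}) dx dy)`. -/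
def MemZ (s r₁ r₂ : ℝ) (u : Plane → ℂ) : Prop :=
  MemH s u ∧
    MemLp u 2 ((volume : Measure Plane).withDensity fun p =>
      ENNReal.ofReal (|p 0| ^ (2 * r₁) + |p 1| ^ (2 * r₂)))

/-- The constant which normalizes the one-dimensional Stein derivative of order `α`, so that the
latter has Fourier symbol `|ξ|^α`. -/
def dConst (α : ℝ) : ℝ :=
  Real.sqrt Real.pi * 2 ^ (-α) * Real.Gamma (-α / 2) / Real.Gamma ((1 + α) / 2)

/-- `ξ + τ e_j`. -/
def shift (j : Fin 2) (ξ : Plane) (τ : ℝ) : Plane := ξ + τ • EuclideanSpace.single j (1 : ℝ)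

/-- The integrand
`(e^{it(φ(ξ + τ e_j) - φ(ξ))} - 1) / |τ|^{1+α} · f(ξ + τ e_j)` in the variable `τ`. -/
def phiIntegrand (j : Fin 2) (t α : ℝ) (f : Plane → ℂ) (ξ : Plane) (τ : ℝ) : ℂ :=
  (Complex.exp (Complex.I * ((t * (phase (shift j ξ τ) - phase ξ) : ℝ) : ℂ)) - 1) /
    ((|τ| ^ (1 + α) : ℝ) : ℂ) * f (shift j ξ τ)

/-- The truncated integral over `|τ| ≥ ε`, divided by the normalizing constant. -/
def phiTrunc (j : Fin 2) (t α : ℝ) (f : Plane → ℂ) (ξ : Plane) (ε : ℝ) : ℂ :=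
  ((dConst α)⁻¹ : ℝ) * ∫ τ in {τ : ℝ | ε ≤ |τ|}, phiIntegrand j t α f ξ τ

/-- `Φ_{j,t,α}(f)(ξ) = lim_{ε → 0+} d_α⁻¹ ∫_{|τ| ≥ ε} …`, with `j = 0, 1` for the first and the
second variable. -/
def Phi (j : Fin 2) (t α : ℝ) (f : Plane → ℂ) (ξ : Plane) : ℂ :=
  limUnder (𝓝[>] (0 : ℝ)) (phiTrunc j t α f ξ)

/-- `Φ_{j,t,α}(f)` is well defined almost everywhere: the truncated integrals converge absolutely
and they have a limit as `ε → 0+`. -/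
def PhiDefined (j : Fin 2) (t α : ℝ) (f : Plane → ℂ) : Prop :=
  ∀ᵐ ξ ∂(volume : Measure Plane),
    (∀ ε > 0, IntegrableOn (phiIntegrand j t α f ξ) {τ : ℝ | ε ≤ |τ|}) ∧
      Tendsto (phiTrunc j t α f ξ) (𝓝[>] (0 : ℝ)) (𝓝 (Phi j t α f ξ))

/-- The `L²(ℝ²)` norm, with values in `[0, ∞]`. -/
def norm2 (f : Plane → ℂ) : ℝ≥0∞ := eLpNorm f 2 (volume : Measure Plane)

end ZK

end

open ZK

/-!
Write `f` for the Fourier transform of `u` and `E = e^{itφ}`. On the frequency side multiplication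
by `|x_j|^r` is the one-dimensional Stein derivative in the `j`-th variable,
`D^r f(ζ) = d_r⁻¹ ∫ (f(ζ + τ e_j) - f(ζ)) |τ|^{-1-r} dτ`, and splitting the difference
`E f(ζ + τ e_j) - E f(ζ)` gives `D^r(E f) = E (D^r f + Φ f)`. This is the asserted formula.

To make this rigorous for `f` merely in `L²`, the integral is truncated to `|τ| ≥ ε`. The truncated
operator is convolution with an integrable kernel along a line, hence a multiplier on the space side
(`fourierInv_lineConv`), whose symbol `steinSymbol` is bounded by a constant times `|x_j|^r` and
tends to `|x_j|^r`; here the value of `d_r` enters, which is computed by writing `|τ|^{-1-r}` as a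
superposition of Gaussians (`integral_one_sub_cos_div`). The truncated formula
(`steinSymbol_mul_W`) is exact. Its right-hand side converges in `L²` and its left-hand side
pointwise (`weight_W`).

The convergence and the bounds for `Φ` rest on one estimate. With `M = 1 + |ζ + τ e_j|²` the mean
value bound `|φ(ζ + τ e_j) - φ(ζ)| ≤ 5 |τ| (M + τ²)` shows that the integrand of `Φ` is at most
`20 (1 + |t|) min(1, |τ| M) |τ|^{-1-r} |f(ζ + τ e_j)|`. The mass of this kernel in `τ` is `O(M^r)`,
and `M` changes by a bounded factor over increments `|τ| ≤ 1`, while for `|τ| ≥ 1` the kernel is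
integrable even against `|τ|^β` with `β < r`. Schur's test with weight `M^r`
(`lintegral_sq_lintegral_shift_le`) therefore bounds `(1 + |ζ|²)^{β/2} Φ f` in `L²` by
`(1 + |ζ|²)^{r + β/2} f` (`exists_lintegral_phiMajorant_le`), and the latter weight is at most
`9 (1 + |ξ|^σ + |η|^σ)` for every `σ ≥ 2r + β`, which makes the constant independent of `s`. The
case `β = 0` is the first part; the case `β > 0` allows `D^β`, a multiplier commuting with `W(t)`,
to be applied to the formula.
-/

namespace ZK

open scoped ComplexConjugate

/-! ### The unitary Fourier transform as an operator on functions -/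

/-- `𝓕⁻` is symmetric for the bilinear pairing. Tested on Schwartz functions this identifies inverse
transforms in `L²`, where no integral formula is available. -/
lemma integral_mul_fourierInv_Lp (φ : 𝓢(Plane, ℂ)) (G : Lp ℂ 2 (volume : Measure Plane)) :
    ∫ x, φ x * (𝓕⁻ G : Lp ℂ 2 (volume : Measure Plane)) x = ∫ x, (𝓕⁻ φ) x * G x := by
  have h := DFunLike.congr_fun (Lp.fourierInv_toTemperedDistribution_eq G) φ
  rw [TemperedDistribution.fourierInv_apply] at h
  simp only [Lp.toTemperedDistribution_apply, smul_eq_mul] at h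
  exact h.symm

lemma ae_eq_of_integral_schwartz_mul_eq {A : Lp ℂ 2 (volume : Measure Plane)} {B : Plane → ℂ}
    (hB : MemLp B 2 volume) (h : ∀ φ : 𝓢(Plane, ℂ), ∫ x, φ x * A x = ∫ x, φ x * B x) :
    A =ᵐ[volume] B := by
  have hk := LinearMap.ker_eq_bot.mp
    (Lp.ker_toTemperedDistributionCLM_eq_bot (F := ℂ) (μ := (volume : Measure Plane)) (p := 2))
  have : A = hB.toLp B := by
    apply hk
    ext φ
    simp only [ContinuousLinearMap.coe_coe, Lp.toTemperedDistributionCLM_apply,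
      Lp.toTemperedDistribution_apply, smul_eq_mul]
    rw [h φ]
    apply integral_congr_ae
    filter_upwards [hB.coeFn_toLp] with x hx
    rw [hx]
  rw [this]
  exact hB.coeFn_toLp

lemma memLp_comp_smul {c : ℝ} (hc : c ≠ 0) {G : Plane → ℂ} (hG : MemLp G 2 volume) :
    MemLp (fun x => G (c • x)) 2 volume := by
  have hm : MemLp G 2 (Measure.map (c • ·) (volume : Measure Plane)) := by
    rw [Measure.map_addHaar_smul _ hc]
    exact hG.smul_measure (by simp)
  exact hm.comp_of_map (by fun_prop)

lemma integral_comp_smul_plane {c : ℝ} (hc : 0 < c) (f : Plane → ℂ) :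
    ∫ x, f (c • x) = (((c ^ 2)⁻¹ : ℝ) : ℂ) * ∫ x, f x := by
  rw [Measure.integral_comp_smul volume f c]
  simp [abs_of_pos hc]

/-- The dilation rule for `𝓕⁻` on `L²(ℝ²)`, by testing against Schwartz functions. -/
lemma fourierInv_Lp_comp_smul {c : ℝ} (hc : 0 < c) (G : Lp ℂ 2 (volume : Measure Plane))
    (hG : MemLp (fun x => G (c • x)) 2 volume) :
    (𝓕⁻ (hG.toLp _) : Lp ℂ 2 (volume : Measure Plane)) =ᵐ[volume]
      fun x => (((c ^ 2)⁻¹ : ℝ) : ℂ) * (𝓕⁻ G : Lp ℂ 2 (volume : Measure Plane)) (c⁻¹ • x) := by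
  refine ae_eq_of_integral_schwartz_mul_eq
    ((memLp_comp_smul (inv_ne_zero hc.ne') (Lp.memLp _)).const_mul _) fun φ => ?_
  rw [integral_mul_fourierInv_Lp]
  let e : Plane ≃L[ℝ] Plane := ContinuousLinearEquiv.smulLeft (Units.mk0 c⁻¹ (inv_ne_zero hc.ne'))
  let ψ : 𝓢(Plane, ℂ) := SchwartzMap.compCLMOfContinuousLinearEquiv ℂ e (𝓕⁻ φ)
  have hψ : ∀ x, ψ x = (𝓕⁻ φ) (c⁻¹ • x) := fun x => rfl
  have hFψ : ∀ x, (𝓕 ψ) x = ((c ^ 2 : ℝ) : ℂ) * φ (c • x) := by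
    intro x
    rw [SchwartzMap.fourier_coe, Real.fourier_eq]
    have h1 : ∀ v : Plane, Real.fourierChar (-(inner ℝ v x)) • ψ v =
        (fun w : Plane => Real.fourierChar (-(inner ℝ w (c • x))) • (𝓕⁻ φ) w) (c⁻¹ • v) := by
      intro v
      simp only [hψ, inner_smul_left, inner_smul_right]
      congr 3
      simp [hc.ne']
    rw [integral_congr_ae (Eventually.of_forall h1), integral_comp_smul_plane (inv_pos.2 hc)
      (fun w => Real.fourierChar (-(inner ℝ w (c • x))) • (𝓕⁻ φ : 𝓢(Plane, ℂ)) w)]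
    have h2 : ∫ w : Plane, Real.fourierChar (-(inner ℝ w (c • x))) • (𝓕⁻ φ) w = φ (c • x) := by
      rw [← Real.fourier_eq, ← SchwartzMap.fourier_coe, FourierTransform.fourier_fourierInv_eq]
    rw [h2]
    simp
  have h3 := integral_mul_fourierInv_Lp (𝓕 ψ) G
  rw [FourierTransform.fourierInv_fourier_eq] at h3
  have h4 : ∫ x, (𝓕⁻ φ) x * (hG.toLp _ : Lp ℂ 2 (volume : Measure Plane)) x
      = ∫ x, (fun y => ψ y * G y) (c • x) := by
    apply integral_congr_ae
    filter_upwards [hG.coeFn_toLp] with x hx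
    rw [hx]
    simp [hψ, hc.ne', smul_smul]
  rw [h4, integral_comp_smul_plane hc (fun y => ψ y * G y), ← h3]
  have h5 : ∫ x, φ x * ((((c ^ 2)⁻¹ : ℝ) : ℂ) * (𝓕⁻ G : Lp ℂ 2 (volume : Measure Plane)) (c⁻¹ • x))
      = ∫ x, (fun y => (((c ^ 2)⁻¹ : ℝ) : ℂ) * (φ (c • y) *
        (𝓕⁻ G : Lp ℂ 2 (volume : Measure Plane)) y)) (c⁻¹ • x) := by
    congr 1; ext x
    simp only [smul_smul, mul_inv_cancel₀ hc.ne', one_smul]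
    ring
  rw [h5, integral_comp_smul_plane (inv_pos.2 hc) (fun y => (((c ^ 2)⁻¹ : ℝ) : ℂ) * (φ (c • y) *
    (𝓕⁻ G : Lp ℂ 2 (volume : Measure Plane)) y)), integral_const_mul]
  simp_rw [hFψ, mul_assoc]
  rw [integral_const_mul]
  push_cast
  field_simp

/-- The translation rule for `𝓕⁻` on `L²(ℝ²)`, by testing against Schwartz functions. -/
lemma fourierInv_Lp_comp_add (a : Plane) (G : Lp ℂ 2 (volume : Measure Plane))
    (hG : MemLp (fun x => G (x + a)) 2 volume) :
    (𝓕⁻ (hG.toLp _) : Lp ℂ 2 (volume : Measure Plane)) =ᵐ[volume]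
      fun x => (Real.fourierChar (-(inner ℝ a x)) : ℂ) *
        (𝓕⁻ G : Lp ℂ 2 (volume : Measure Plane)) x := by
  have hB : MemLp (fun x => (Real.fourierChar (-(inner ℝ a x)) : ℂ) *
      (𝓕⁻ G : Lp ℂ 2 (volume : Measure Plane)) x) 2 volume := by
    refine (Lp.memLp (𝓕⁻ G)).of_le ?_ ?_
    · refine AEStronglyMeasurable.mul ?_ (Lp.aestronglyMeasurable _)
      have : Continuous fun x : Plane => (Real.fourierChar (-(inner ℝ a x)) : ℂ) := by
        have := Real.continuous_fourierChar
        fun_prop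
      exact this.aestronglyMeasurable
    · filter_upwards with x
      rw [norm_mul, Circle.norm_coe, one_mul]
  refine ae_eq_of_integral_schwartz_mul_eq hB fun φ => ?_
  rw [integral_mul_fourierInv_Lp]
  let ψ : 𝓢(Plane, ℂ) := SchwartzMap.compSubConstCLM ℂ a (𝓕⁻ φ)
  have hψ : ∀ x, ψ x = (𝓕⁻ φ) (x - a) := fun x => rfl
  have hFψ : ∀ x, (𝓕 ψ) x = (Real.fourierChar (-(inner ℝ a x)) : ℂ) * φ x := by
    intro x
    have h1 : (ψ : Plane → ℂ) = (𝓕⁻ φ : 𝓢(Plane, ℂ)) ∘ fun v => v + (-a) := by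
      ext v; simp [hψ, sub_eq_add_neg]
    have h2 : (𝓕 (𝓕⁻ φ : 𝓢(Plane, ℂ)) : 𝓢(Plane, ℂ)) x = φ x := by
      rw [FourierTransform.fourier_fourierInv_eq]
    rw [SchwartzMap.fourier_coe, h1]
    have := congrFun (VectorFourier.fourierIntegral_comp_add_right Real.fourierChar
      (volume : Measure Plane) (innerₗ Plane) (𝓕⁻ φ : 𝓢(Plane, ℂ)) (-a)) x
    refine this.trans ?_
    rw [Circle.smul_def, smul_eq_mul]
    congr 1
    · simp
  have h3 := integral_mul_fourierInv_Lp (𝓕 ψ) G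
  rw [FourierTransform.fourierInv_fourier_eq] at h3
  have h4 : ∫ x, (𝓕⁻ φ) x * (hG.toLp _ : Lp ℂ 2 (volume : Measure Plane)) x
      = ∫ x, (fun y => ψ y * G y) (x + a) := by
    apply integral_congr_ae
    filter_upwards [hG.coeFn_toLp] with x hx
    rw [hx]
    simp [hψ]
  rw [h4, integral_add_right_eq_self (fun y => ψ y * G y), ← h3]
  congr 1; ext x
  rw [hFψ]; ring

lemma fourier_of_memLp {f : Plane → ℂ} (hf : MemLp f 2 volume) :
    fourier f = fun ξ => (((2 * Real.pi)⁻¹ : ℝ) : ℂ) *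
      (𝓕 (hf.toLp f) : Lp ℂ 2 (volume : Measure Plane)) ((2 * Real.pi)⁻¹ • ξ) :=
  dif_pos hf

lemma fourierInv_of_memLp {f : Plane → ℂ} (hf : MemLp f 2 volume) :
    fourierInv f = fun ξ => (((2 * Real.pi)⁻¹ : ℝ) : ℂ) *
      (𝓕⁻ (hf.toLp f) : Lp ℂ 2 (volume : Measure Plane)) ((2 * Real.pi)⁻¹ • ξ) :=
  dif_pos hf

lemma two_pi_inv_pos : 0 < (2 * Real.pi)⁻¹ := by positivity

lemma memLp_fourier (f : Plane → ℂ) : MemLp (fourier f) 2 volume := by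
  by_cases hf : MemLp f 2 volume
  · rw [fourier_of_memLp hf]
    exact (memLp_comp_smul two_pi_inv_pos.ne' (Lp.memLp _)).const_mul _
  · rw [fourier, dif_neg hf]
    exact MemLp.zero'

lemma memLp_fourierInv (f : Plane → ℂ) : MemLp (fourierInv f) 2 volume := by
  by_cases hf : MemLp f 2 volume
  · rw [fourierInv_of_memLp hf]
    exact (memLp_comp_smul two_pi_inv_pos.ne' (Lp.memLp _)).const_mul _
  · rw [fourierInv, dif_neg hf]
    exact MemLp.zero'

/-- The function `fourier f` is measurable on the nose, since Mathlib represents classes in `Lp`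
by strongly measurable functions. -/
lemma measurable_fourier (f : Plane → ℂ) : Measurable (fourier f) := by
  by_cases hf : MemLp f 2 volume
  · rw [fourier_of_memLp hf]
    exact ((Lp.stronglyMeasurable _).measurable.comp (measurable_const_smul _)).const_mul _
  · rw [fourier, dif_neg hf]
    exact measurable_zero

lemma fourier_congr {f g : Plane → ℂ} (h : f =ᵐ[volume] g) : fourier f = fourier g := by
  by_cases hf : MemLp f 2 volume
  · have hg := (memLp_congr_ae h).1 hf
    rw [fourier_of_memLp hf, fourier_of_memLp hg, MemLp.toLp_congr hf hg h]
  · have hg := fun hg => hf ((memLp_congr_ae h).2 hg)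
    rw [fourier, fourier, dif_neg hf, dif_neg hg]

lemma fourierInv_congr {f g : Plane → ℂ} (h : f =ᵐ[volume] g) :
    fourierInv f = fourierInv g := by
  by_cases hf : MemLp f 2 volume
  · have hg := (memLp_congr_ae h).1 hf
    rw [fourierInv_of_memLp hf, fourierInv_of_memLp hg, MemLp.toLp_congr hf hg h]
  · have hg := fun hg => hf ((memLp_congr_ae h).2 hg)
    rw [fourierInv, fourierInv, dif_neg hf, dif_neg hg]

lemma fourierInv_Lp_dilate {c : ℝ} (hc : 0 < c) {f : Plane → ℂ} (hf : MemLp f 2 volume)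
    (hg : MemLp (fun x => (c : ℂ) * (𝓕 (hf.toLp f) : Lp ℂ 2 (volume : Measure Plane)) (c • x))
      2 volume) :
    (𝓕⁻ (hg.toLp _) : Lp ℂ 2 (volume : Measure Plane)) =ᵐ[volume]
      fun x => ((c⁻¹ : ℝ) : ℂ) * f (c⁻¹ • x) := by
  have h0 : MemLp (fun x => (𝓕 (hf.toLp f) : Lp ℂ 2 (volume : Measure Plane)) (c • x)) 2 volume :=
    memLp_comp_smul hc.ne' (Lp.memLp _)
  have h1 := fourierInv_Lp_comp_smul hc (𝓕 (hf.toLp f)) h0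
  rw [FourierTransform.fourierInv_fourier_eq] at h1
  have h2 : hg.toLp _ = (c : ℂ) • h0.toLp _ := rfl
  rw [h2, FourierTransform.fourierInv_smul]
  have h3 := (Measure.quasiMeasurePreserving_smul (volume : Measure Plane)
    (inv_ne_zero hc.ne')).ae_eq_comp hf.coeFn_toLp
  filter_upwards [h1, Lp.coeFn_smul (c : ℂ) (𝓕⁻ (h0.toLp _) : Lp ℂ 2 (volume : Measure Plane)), h3]
    with x hx1 hx2 hx3
  simp only [Function.comp_apply] at hx3
  rw [hx2, Pi.smul_apply, hx1, hx3, smul_eq_mul]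
  push_cast
  have : (c : ℂ) ≠ 0 := by exact_mod_cast hc.ne'
  field_simp

lemma fourierInv_fourier {f : Plane → ℂ} (hf : MemLp f 2 volume) :
    fourierInv (fourier f) =ᵐ[volume] f := by
  have hg := memLp_fourier f
  rw [fourierInv_of_memLp hg]
  rw [fourier_of_memLp hf] at hg
  have h1 := fourierInv_Lp_dilate two_pi_inv_pos hf hg
  have h2 := (Measure.quasiMeasurePreserving_smul (volume : Measure Plane)
    two_pi_inv_pos.ne').ae_eq_comp h1
  have h3 : (memLp_fourier f).toLp _ = hg.toLp _ :=
    MemLp.toLp_congr _ _ (by rw [fourier_of_memLp hf])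
  rw [h3]
  filter_upwards [h2] with x hx
  simp only [Function.comp_apply] at hx
  rw [hx, smul_smul, inv_mul_cancel₀ two_pi_inv_pos.ne', one_smul, ← mul_assoc, ← Complex.ofReal_mul,
    mul_inv_cancel₀ two_pi_inv_pos.ne']
  simp

lemma fourier_fourierInv {g : Plane → ℂ} (hg : MemLp g 2 volume) :
    fourier (fourierInv g) =ᵐ[volume] g := by
  obtain ⟨c, hc_def⟩ : ∃ c, c = (2 * Real.pi)⁻¹ := ⟨_, rfl⟩
  have hc : 0 < c := hc_def ▸ two_pi_inv_pos
  have hH : MemLp (fun x => (hg.toLp g : Lp ℂ 2 (volume : Measure Plane)) (c⁻¹ • x)) 2 volume :=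
    memLp_comp_smul (inv_ne_zero hc.ne') (Lp.memLp _)
  have h1 := fourierInv_Lp_comp_smul (inv_pos.2 hc) (hg.toLp g) hH
  have hI := memLp_fourierInv g
  have h2 : hI.toLp _ = ((c⁻¹ : ℝ) : ℂ) • (𝓕⁻ (hH.toLp _) : Lp ℂ 2 (volume : Measure Plane)) := by
    apply Lp.ext
    filter_upwards [hI.coeFn_toLp, h1, Lp.coeFn_smul ((c⁻¹ : ℝ) : ℂ)
      (𝓕⁻ (hH.toLp _) : Lp ℂ 2 (volume : Measure Plane))] with x hx1 hx2 hx3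
    rw [hx1, hx3, Pi.smul_apply, hx2, fourierInv_of_memLp hg, smul_eq_mul]
    have : (c : ℂ) ≠ 0 := by exact_mod_cast hc.ne'
    rw [← hc_def, inv_inv]
    push_cast
    field_simp
  rw [fourier_of_memLp hI, h2, FourierTransform.fourier_smul,
    FourierTransform.fourier_fourierInv_eq, ← hc_def]
  have h3 := (Measure.quasiMeasurePreserving_smul (volume : Measure Plane) hc.ne').ae_eq_comp
    (Lp.coeFn_smul ((c⁻¹ : ℝ) : ℂ) (hH.toLp _))
  have h4 := (Measure.quasiMeasurePreserving_smul (volume : Measure Plane) hc.ne').ae_eq_comp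
    hH.coeFn_toLp
  filter_upwards [h3, h4, hg.coeFn_toLp] with x hx3 hx4 hx5
  simp only [Function.comp_apply, Pi.smul_apply, smul_eq_mul] at hx3 hx4
  rw [hx3, hx4, smul_smul, inv_mul_cancel₀ hc.ne', one_smul, hx5, ← mul_assoc,
    ← Complex.ofReal_mul, mul_inv_cancel₀ hc.ne']
  simp

lemma integral_conj_mul_eq_inner {f g : Plane → ℂ} (hf : MemLp f 2 volume)
    (hg : MemLp g 2 volume) :
    ∫ x, conj (f x) * g x = inner ℂ (hf.toLp f) (hg.toLp g) := by
  rw [L2.inner_def]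
  apply integral_congr_ae
  filter_upwards [hf.coeFn_toLp, hg.coeFn_toLp] with x h1 h2
  rw [h1, h2, RCLike.inner_apply, mul_comm]

/-- Plancherel's identity. -/
lemma integral_conj_fourier_mul {f g : Plane → ℂ} (hf : MemLp f 2 volume)
    (hg : MemLp g 2 volume) :
    ∫ x, conj (fourier f x) * fourier g x = ∫ x, conj (f x) * g x := by
  rw [fourier_of_memLp hf, fourier_of_memLp hg, integral_conj_mul_eq_inner hf hg,
    ← Lp.inner_fourier_eq, L2.inner_def]
  have := integral_comp_smul_plane two_pi_inv_pos (fun x =>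
    ((((2 * Real.pi)⁻¹ : ℝ) : ℂ) ^ 2) * inner ℂ
      ((𝓕 (hf.toLp f) : Lp ℂ 2 (volume : Measure Plane)) x)
      ((𝓕 (hg.toLp g) : Lp ℂ 2 (volume : Measure Plane)) x))
  rw [integral_const_mul (μ := volume) _ (fun x => inner ℂ
      ((𝓕 (hf.toLp f) : Lp ℂ 2 (volume : Measure Plane)) x)
      ((𝓕 (hg.toLp g) : Lp ℂ 2 (volume : Measure Plane)) x)),
    ← mul_assoc, ← Complex.ofReal_pow, ← Complex.ofReal_mul,
    inv_mul_cancel₀ (by positivity), Complex.ofReal_one, one_mul] at this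
  rw [← this]
  congr 1; ext x
  simp only [RCLike.inner_apply, map_mul, Complex.conj_ofReal]
  push_cast
  ring

lemma norm2_eq_of_integral_conj {f g : Plane → ℂ} (hf : MemLp f 2 volume)
    (hg : MemLp g 2 volume)
    (h : ∫ x, conj (f x) * f x = ∫ x, conj (g x) * g x) : norm2 f = norm2 g := by
  rw [integral_conj_mul_eq_inner hf hf, integral_conj_mul_eq_inner hg hg,
    inner_self_eq_norm_sq_to_K, inner_self_eq_norm_sq_to_K] at h
  have h2 : ‖hf.toLp f‖ = ‖hg.toLp g‖ := by
    rw [← sq_eq_sq₀ (norm_nonneg _) (norm_nonneg _)]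
    exact_mod_cast h
  rw [Lp.norm_toLp, Lp.norm_toLp] at h2
  exact (ENNReal.toReal_eq_toReal_iff' hf.2.ne hg.2.ne).1 h2

lemma norm2_fourier {f : Plane → ℂ} (hf : MemLp f 2 volume) : norm2 (fourier f) = norm2 f :=
  norm2_eq_of_integral_conj (memLp_fourier f) hf (integral_conj_fourier_mul hf hf)

lemma norm2_fourierInv {g : Plane → ℂ} (hg : MemLp g 2 volume) :
    norm2 (fourierInv g) = norm2 g := by
  rw [← norm2_fourier (memLp_fourierInv g)]
  exact eLpNorm_congr_ae (fourier_fourierInv hg)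

lemma integral_conj_mul_fourierInv {h g : Plane → ℂ} (hh : MemLp h 2 volume)
    (hg : MemLp g 2 volume) :
    ∫ x, conj (h x) * fourierInv g x = ∫ x, conj (fourier h x) * g x := by
  rw [← integral_conj_fourier_mul hh (memLp_fourierInv g)]
  apply integral_congr_ae
  filter_upwards [fourier_fourierInv hg] with x hx
  rw [hx]

lemma ae_eq_of_integral_conj_mul_eq {A B : Plane → ℂ} (hA : MemLp A 2 volume)
    (hB : MemLp B 2 volume)
    (h : ∀ H : Plane → ℂ, MemLp H 2 volume → ∫ x, conj (H x) * A x = ∫ x, conj (H x) * B x) :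
    A =ᵐ[volume] B := by
  have : hA.toLp A = hB.toLp B := by
    refine ext_inner_left ℂ fun v => ?_
    have hv : v = (Lp.memLp v).toLp v := (Lp.toLp_coeFn v _).symm
    rw [hv, ← integral_conj_mul_eq_inner, ← integral_conj_mul_eq_inner]
    exact h _ (Lp.memLp v)
  exact (MemLp.toLp_eq_toLp_iff hA hB).1 this

lemma fourierInv_add {f g : Plane → ℂ} (hf : MemLp f 2 volume) (hg : MemLp g 2 volume) :
    fourierInv (f + g) =ᵐ[volume] fourierInv f + fourierInv g := by
  rw [fourierInv_of_memLp hf, fourierInv_of_memLp hg, fourierInv_of_memLp (hf.add hg),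
    MemLp.toLp_add hf hg, FourierTransform.fourierInv_add]
  have := (Measure.quasiMeasurePreserving_smul (volume : Measure Plane)
    two_pi_inv_pos.ne').ae_eq_comp (Lp.coeFn_add (𝓕⁻ (hf.toLp f) : Lp ℂ 2 (volume : Measure Plane))
      (𝓕⁻ (hg.toLp g)))
  filter_upwards [this] with x hx
  simp only [Function.comp_apply, Pi.add_apply] at hx
  simp only [Pi.add_apply]
  rw [hx, mul_add]

lemma fourierInv_sub {f g : Plane → ℂ} (hf : MemLp f 2 volume) (hg : MemLp g 2 volume) :
    fourierInv (f - g) =ᵐ[volume] fourierInv f - fourierInv g := by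
  have h := fourierInv_add (hf.sub hg) hg
  rw [sub_add_cancel] at h
  filter_upwards [h] with x hx
  simp only [Pi.add_apply] at hx
  simp [hx]

lemma fourier_add {f g : Plane → ℂ} (hf : MemLp f 2 volume) (hg : MemLp g 2 volume) :
    fourier (f + g) =ᵐ[volume] fourier f + fourier g := by
  have h := fourierInv_add (memLp_fourier f) (memLp_fourier g)
  have h2 : fourierInv (fourier f + fourier g) =ᵐ[volume] f + g :=
    h.trans ((fourierInv_fourier hf).add (fourierInv_fourier hg))
  rw [← fourier_congr h2]
  exact fourier_fourierInv ((memLp_fourier f).add (memLp_fourier g))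

lemma fourierInv_comp_add (a : Plane) {g : Plane → ℂ} (hg : MemLp g 2 volume) :
    fourierInv (fun x => g (x + a)) =ᵐ[volume]
      fun x => Complex.exp (-(Complex.I * (inner ℝ a x : ℝ))) * fourierInv g x := by
  have hmp : MeasurePreserving (fun x : Plane => x + a) volume volume :=
    measurePreserving_add_right _ a
  have hga : MemLp (fun x => g (x + a)) 2 volume := hg.comp_measurePreserving hmp
  have hG : MemLp (fun x => (hg.toLp g : Lp ℂ 2 (volume : Measure Plane)) (x + a)) 2 volume :=
    (Lp.memLp _).comp_measurePreserving hmp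
  have h0 : hga.toLp _ = hG.toLp _ :=
    MemLp.toLp_congr _ _ (hmp.quasiMeasurePreserving.ae_eq_comp hg.coeFn_toLp).symm
  rw [fourierInv_of_memLp hga, fourierInv_of_memLp hg, h0]
  have h1 := (Measure.quasiMeasurePreserving_smul (volume : Measure Plane)
    two_pi_inv_pos.ne').ae_eq_comp (fourierInv_Lp_comp_add a (hg.toLp g) hG)
  filter_upwards [h1] with x hx
  simp only [Function.comp_apply] at hx
  rw [hx, inner_smul_right, Real.fourierChar_apply]
  have : ((2 * Real.pi * -((2 * Real.pi)⁻¹ * inner ℝ a x) : ℝ) : ℂ) * Complex.I =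
      -(Complex.I * (inner ℝ a x : ℝ)) := by
    have : (2 * Real.pi * -((2 * Real.pi)⁻¹ * inner ℝ a x) : ℝ) = - inner ℝ a x := by
      have := Real.pi_ne_zero
      field_simp
    rw [this]; push_cast; ring
  rw [this]
  ring

/-! ### The normalizing constant of the Stein derivative -/

/-- The kernel `min(1, M|τ|) / |τ|^{1+α}`, which dominates the integrands of the Stein derivative
and of `Φ`. -/
noncomputable def kern (α M τ : ℝ) : ℝ := min 1 (|τ| * M) / |τ| ^ (1 + α)

lemma kern_nonneg {α M : ℝ} (hM : 0 ≤ M) (τ : ℝ) : 0 ≤ kern α M τ := by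
  unfold kern; positivity

lemma measurable_kern (α : ℝ) : Measurable fun p : ℝ × ℝ => kern α p.1 p.2 := by
  unfold kern; fun_prop

lemma integrable_comp_abs {g : ℝ → ℝ} (hg : IntegrableOn g (Set.Ioi 0)) :
    Integrable fun x => g |x| := by
  have h1 : IntegrableOn (fun x => g |x|) (Set.Ioi 0) :=
    hg.congr_fun (fun x hx => by rw [abs_of_pos hx]) measurableSet_Ioi
  have h2 : IntegrableOn (fun x => g |x|) (Set.Iic 0) := by
    have := integrableOn_Ici_iff_integrableOn_Ioi (hb := by simp) |>.2 h1
    rw [← neg_zero] at this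
    simpa using this.comp_neg_Iic
  rw [← integrableOn_univ, ← Set.Iic_union_Ioi (a := (0 : ℝ))]
  exact h2.union h1

lemma integrable_kern_one {α : ℝ} (h0 : 0 < α) (h1 : α < 1) : Integrable (kern α 1) := by
  have : IntegrableOn (fun x : ℝ => min 1 x / x ^ (1 + α)) (Set.Ioi 0) := by
    rw [← Set.Ioc_union_Ioi_eq_Ioi zero_le_one]
    refine IntegrableOn.union ?_ ?_
    · have h := (intervalIntegral.intervalIntegrable_rpow' (r := -α) (a := 0) (b := 1)
        (by linarith)).1
      refine h.congr_fun (fun x hx => ?_) measurableSet_Ioc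
      simp only
      rw [min_eq_right hx.2, Real.rpow_add hx.1, Real.rpow_one, Real.rpow_neg hx.1.le]
      have := hx.1.ne'
      have := (Real.rpow_pos_of_pos hx.1 α).ne'
      field_simp
    · refine (integrableOn_Ioi_rpow_of_lt (a := -(1 + α)) (by linarith) one_pos).congr_fun
        (fun x hx => ?_) measurableSet_Ioi
      simp only
      have hx' : (1 : ℝ) < x := hx
      rw [min_eq_left hx'.le, Real.rpow_neg (by linarith), one_div]
  refine (integrable_comp_abs this).congr (Eventually.of_forall fun x => ?_)
  simp [kern]

lemma kern_scale {α M : ℝ} (hM : 0 < M) (τ : ℝ) :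
    kern α M τ = M ^ (1 + α) * kern α 1 (τ * M) := by
  unfold kern
  rw [abs_mul, abs_of_pos hM, mul_one, Real.mul_rpow (abs_nonneg _) hM.le]
  have := (Real.rpow_pos_of_pos hM (1 + α)).ne'
  rw [mul_comm (|τ| ^ (1 + α)), ← mul_div_assoc, mul_div_mul_left _ _ this]

lemma integrable_kern {α M : ℝ} (h0 : 0 < α) (h1 : α < 1) (hM : 0 < M) :
    Integrable (kern α M) := by
  refine (((integrable_kern_one h0 h1).comp_mul_right' hM.ne').const_mul (M ^ (1 + α))).congr
    (Eventually.of_forall fun x => ?_)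
  simp [kern_scale hM x]

lemma integral_kern {α M : ℝ} (hM : 0 < M) :
    ∫ τ, kern α M τ = M ^ α * ∫ τ, kern α 1 τ := by
  simp_rw [kern_scale hM]
  rw [integral_const_mul, Measure.integral_comp_mul_right (kern α 1), abs_of_pos (inv_pos.2 hM),
    Real.rpow_add hM, Real.rpow_one, smul_eq_mul]
  field_simp

lemma norm_exp_I_mul_sub_one_le (θ : ℝ) :
    ‖Complex.exp (Complex.I * θ) - 1‖ ≤ 2 * min 1 |θ| := by
  rw [mul_min_of_nonneg _ _ zero_le_two, le_min_iff]
  constructor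
  · refine (norm_sub_le _ _).trans ?_
    rw [Complex.norm_exp_I_mul_ofReal]; norm_num
  · refine Real.norm_exp_I_mul_ofReal_sub_one_le.trans ?_
    rw [Real.norm_eq_abs]; linarith [abs_nonneg θ]

/-- The integrand of the Stein derivative of `τ ↦ e^{-iτx}` at `τ = 0`. -/
noncomputable def expKernel (α x τ : ℝ) : ℂ :=
  (Complex.exp (Complex.I * ((-(τ * x) : ℝ) : ℂ)) - 1) / ((|τ| ^ (1 + α) : ℝ) : ℂ)

lemma norm_expKernel_le (α x τ : ℝ) : ‖expKernel α x τ‖ ≤ 2 * kern α |x| τ := by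
  unfold expKernel kern
  rw [norm_div, Complex.norm_real, Real.norm_of_nonneg (by positivity), ← mul_div_assoc]
  gcongr
  refine (norm_exp_I_mul_sub_one_le _).trans ?_
  rw [abs_neg, abs_mul]

lemma measurable_expKernel (α : ℝ) : Measurable fun p : ℝ × ℝ => expKernel α p.1 p.2 := by
  unfold expKernel; fun_prop

lemma expKernel_zero (α τ : ℝ) : expKernel α 0 τ = 0 := by simp [expKernel]

lemma integrable_expKernel {α : ℝ} (h0 : 0 < α) (h1 : α < 1) (x : ℝ) :
    Integrable (expKernel α x) := by
  rcases eq_or_ne x 0 with rfl | hx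
  · simp only [funext (expKernel_zero α)]; exact integrable_zero _ _ _
  · refine ((integrable_kern h0 h1 (abs_pos.2 hx)).const_mul 2).mono' ?_
      (Eventually.of_forall (norm_expKernel_le α x))
    exact ((measurable_expKernel α).comp measurable_prodMk_left).aestronglyMeasurable

/-- Obtained by writing `1 - e^{-ly}` as an integral in `v ∈ (0, l)` and exchanging the integrals. -/
lemma integral_rpow_mul_one_sub_exp {b l : ℝ} (hb0 : 0 < b) (hb1 : b < 1) (hl : 0 < l) :
    ∫ y in Set.Ioi (0 : ℝ), y ^ (-b - 1) * (1 - Real.exp (-(l * y))) =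
      Real.Gamma (1 - b) * l ^ b / b := by
  have hin : ∀ v ∈ Set.Ioc 0 l,
      ∫ y in Set.Ioi (0 : ℝ), y ^ (-b) * Real.exp (-(v * y)) = v ^ (b - 1) * Real.Gamma (1 - b) := by
    intro v hv
    have := Real.integral_rpow_mul_exp_neg_mul_Ioi (a := 1 - b) (r := v) (by linarith) hv.1
    rw [show (1 - b - 1) = -b by ring] at this
    rw [this, one_div, Real.inv_rpow hv.1.le, ← Real.rpow_neg hv.1.le, neg_sub]
  have hI : IntervalIntegrable (fun v : ℝ => v ^ (b - 1)) volume 0 l :=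
    intervalIntegral.intervalIntegrable_rpow' (by linarith)
  have hprod : Integrable (Function.uncurry fun (y v : ℝ) => y ^ (-b) * Real.exp (-(v * y)))
      ((volume.restrict (Set.Ioi 0)).prod (volume.restrict (Set.Ioc 0 l))) := by
    have hm : Measurable (Function.uncurry fun (y v : ℝ) => y ^ (-b) * Real.exp (-(v * y))) := by
      unfold Function.uncurry; fun_prop
    rw [integrable_prod_iff' hm.aestronglyMeasurable]
    constructor
    · filter_upwards [ae_restrict_mem measurableSet_Ioc] with v hv
      have := integrableOn_rpow_mul_exp_neg_mul_rpow (p := 1) (s := -b) (b := v)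
        (by linarith) one_pos hv.1
      refine this.congr_fun (fun y _ => ?_) measurableSet_Ioi
      simp [Function.uncurry]
    · refine ((hI.1.mul_const (Real.Gamma (1 - b)))).congr ?_
      filter_upwards [ae_restrict_mem measurableSet_Ioc] with v hv
      rw [← hin v hv]
      refine setIntegral_congr_fun measurableSet_Ioi fun y hy => ?_
      have hy' : (0 : ℝ) < y := hy
      simp only [Function.uncurry]
      rw [Real.norm_of_nonneg (by positivity)]
  calc _ = ∫ y in Set.Ioi (0 : ℝ), ∫ v in Set.Ioc 0 l, y ^ (-b) * Real.exp (-(v * y)) := by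
        refine setIntegral_congr_fun measurableSet_Ioi fun y hy => ?_
        have hy' : (0 : ℝ) < y := hy
        rw [integral_const_mul, ← intervalIntegral.integral_of_le hl.le]
        have : ∫ v in (0 : ℝ)..l, Real.exp (-(v * y)) = (1 - Real.exp (-(l * y))) / y := by
          have hd : ∀ v ∈ Set.uIcc 0 l,
              HasDerivAt (fun v : ℝ => -(Real.exp (-(v * y)) / y)) (Real.exp (-(v * y))) v := by
            intro v _
            have := (((hasDerivAt_id v).mul_const y).neg.exp.div_const y).neg
            convert! this using 1
            simp only [id, Pi.neg_apply]
            field_simp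
          rw [intervalIntegral.integral_eq_sub_of_hasDerivAt hd]
          · simp; ring
          · exact (by fun_prop : Continuous fun v : ℝ => Real.exp (-(v * y))).intervalIntegrable _ _
        rw [this, Real.rpow_sub hy', Real.rpow_one]
        ring
    _ = ∫ v in Set.Ioc 0 l, ∫ y in Set.Ioi (0 : ℝ), y ^ (-b) * Real.exp (-(v * y)) :=
        integral_integral_swap hprod
    _ = ∫ v in Set.Ioc 0 l, v ^ (b - 1) * Real.Gamma (1 - b) :=
        setIntegral_congr_fun measurableSet_Ioc hin
    _ = _ := by
        rw [integral_mul_const, ← intervalIntegral.integral_of_le hl.le, integral_rpow (by left; linarith)]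
        simp only [sub_add_cancel, Real.zero_rpow hb0.ne', sub_zero]
        ring

lemma integral_one_sub_cos_mul_gaussian {s : ℝ} (hs : 0 < s) :
    ∫ τ : ℝ, (1 - Real.cos τ) * Real.exp (-(s * τ ^ 2)) =
      √(Real.pi / s) * (1 - Real.exp (-(1 / 4 * s⁻¹))) := by
  have hg := integrable_exp_neg_mul_sq hs
  simp only [neg_mul] at hg
  have hc : Integrable fun τ : ℝ => Real.cos τ * Real.exp (-(s * τ ^ 2)) :=
    hg.mono' (by fun_prop) (Eventually.of_forall fun τ => by
      rw [norm_mul, Real.norm_of_nonneg (Real.exp_pos _).le]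
      exact mul_le_of_le_one_left (Real.exp_pos _).le (Real.abs_cos_le_one τ))
  have h1 : ∫ τ : ℝ, Real.cos τ * Real.exp (-(s * τ ^ 2)) =
      √(Real.pi / s) * Real.exp (-(1 / 4 * s⁻¹)) := by
    have h := fourierIntegral_gaussian (b := s) (by simpa using hs) 1
    have h2 : (∫ x : ℝ, Complex.exp (Complex.I * 1 * x) * Complex.exp (-s * (x : ℂ) ^ 2)).re =
        ∫ τ : ℝ, Real.cos τ * Real.exp (-(s * τ ^ 2)) := by
      have hint : Integrable fun x : ℝ =>
          Complex.exp (Complex.I * 1 * x) * Complex.exp (-s * (x : ℂ) ^ 2) := by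
        refine (integrable_cexp_quadratic (b := s) (by simpa using hs) Complex.I 0).congr
          (Eventually.of_forall fun x => ?_)
        simp only
        rw [← Complex.exp_add]; congr 1; ring
      rw [← RCLike.re_eq_complex_re, ← integral_re hint]
      refine integral_congr_ae (Eventually.of_forall fun x => ?_)
      simp only [RCLike.re_eq_complex_re]
      rw [show (-(s : ℂ) * (x : ℂ) ^ 2) = ((-(s * x ^ 2) : ℝ) : ℂ) by push_cast; ring,
        ← Complex.ofReal_exp, mul_comm, Complex.re_ofReal_mul, mul_one, mul_comm Complex.I,
        Complex.exp_ofReal_mul_I_re, mul_comm]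
    rw [← h2, h]
    rw [show (-(1 : ℂ) ^ 2 / (4 * (s : ℂ))) = ((-(1 / 4 * s⁻¹) : ℝ) : ℂ) by
        push_cast; field_simp, ← Complex.ofReal_exp, mul_comm, Complex.re_ofReal_mul,
      show ((Real.pi : ℂ) / s) = ((Real.pi / s : ℝ) : ℂ) by push_cast; rfl,
      show ((1 : ℂ) / 2) = ((1 / 2 : ℝ) : ℂ) by push_cast; rfl,
      ← Complex.ofReal_cpow (by positivity), Complex.ofReal_re, Real.sqrt_eq_rpow, mul_comm]
  have h3 := integral_gaussian s
  simp only [neg_mul] at h3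
  simp_rw [sub_mul, one_mul]
  rw [integral_sub hg hc, h1, h3]
  ring

lemma integrable_one_sub_cos_div {α : ℝ} (h0 : 0 < α) (h1 : α < 1) :
    Integrable fun τ : ℝ => (1 - Real.cos τ) / |τ| ^ (1 + α) := by
  refine (integrable_expKernel h0 h1 1).mono
    (by fun_prop : Measurable _).aestronglyMeasurable (Eventually.of_forall fun τ => ?_)
  have : (1 - Real.cos τ) / |τ| ^ (1 + α) = -(expKernel α 1 τ).re := by
    rw [expKernel, Complex.div_ofReal_re, Complex.sub_re, mul_comm Complex.I,
      Complex.exp_ofReal_mul_I_re]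
    simp; ring
  rw [this, norm_neg]
  exact Complex.abs_re_le_norm _

lemma Gamma_neg_half {α : ℝ} (h0 : 0 < α) :
    Real.Gamma (-α / 2) = -(Real.Gamma (1 - α / 2) / (α / 2)) := by
  have := Real.Gamma_add_one (s := -α / 2) (by linarith)
  rw [show -α / 2 + 1 = 1 - α / 2 by ring] at this
  rw [this]; field_simp

lemma dConst_neg {α : ℝ} (h0 : 0 < α) (h1 : α < 1) : dConst α < 0 := by
  unfold dConst
  rw [Gamma_neg_half h0]
  have g1 := Real.Gamma_pos_of_pos (s := 1 - α / 2) (by linarith)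
  have g2 := Real.Gamma_pos_of_pos (s := (1 + α) / 2) (by linarith)
  refine div_neg_of_neg_of_pos (mul_neg_of_pos_of_neg (by positivity) ?_) g2
  rw [neg_lt_zero]; positivity

/-- The value of the normalizing integral: the power `|τ|^{-1-α}` is a superposition of Gaussians,
for which the integral against `1 - cos τ` is explicit. -/
lemma integral_one_sub_cos_div {α : ℝ} (h0 : 0 < α) (h1 : α < 1) :
    ∫ τ : ℝ, (1 - Real.cos τ) / |τ| ^ (1 + α) = -dConst α := by
  have hΓ := Real.Gamma_pos_of_pos (s := (1 + α) / 2) (by linarith)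
  have hin : ∀ τ : ℝ, τ ≠ 0 →
      ∫ s in Set.Ioi (0 : ℝ), (1 - Real.cos τ) * (s ^ ((1 + α) / 2 - 1) * Real.exp (-(τ ^ 2 * s)))
        = (1 - Real.cos τ) / |τ| ^ (1 + α) * Real.Gamma ((1 + α) / 2) := by
    intro τ hτ
    rw [integral_const_mul, Real.integral_rpow_mul_exp_neg_mul_Ioi (by linarith) (by positivity),
      one_div, Real.inv_rpow (by positivity), ← sq_abs, ← Real.rpow_natCast |τ| 2,
      ← Real.rpow_mul (abs_nonneg _)]
    rw [show ((2 : ℕ) : ℝ) * ((1 + α) / 2) = 1 + α by push_cast; ring]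
    ring
  have hae : ∀ᵐ τ : ℝ, τ ≠ 0 := by
    simp [ae_iff]
  have hprod : Integrable (Function.uncurry fun (τ s : ℝ) =>
      (1 - Real.cos τ) * (s ^ ((1 + α) / 2 - 1) * Real.exp (-(τ ^ 2 * s))))
      ((volume : Measure ℝ).prod (volume.restrict (Set.Ioi 0))) := by
    have hm : Measurable (Function.uncurry fun (τ s : ℝ) =>
      (1 - Real.cos τ) * (s ^ ((1 + α) / 2 - 1) * Real.exp (-(τ ^ 2 * s)))) := by
      unfold Function.uncurry; fun_prop
    rw [integrable_prod_iff hm.aestronglyMeasurable]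
    constructor
    · filter_upwards [hae] with τ hτ
      have := integrableOn_rpow_mul_exp_neg_mul_rpow (p := 1) (s := (1 + α) / 2 - 1) (b := τ ^ 2)
        (by linarith) one_pos (by positivity)
      refine IntegrableOn.congr_fun (this.const_mul (1 - Real.cos τ)) (fun y _ => ?_)
        measurableSet_Ioi
      simp [Function.uncurry]
    · refine ((integrable_one_sub_cos_div h0 h1).mul_const (Real.Gamma ((1 + α) / 2))).congr ?_
      filter_upwards [hae] with τ hτ
      rw [← hin τ hτ]
      refine setIntegral_congr_fun measurableSet_Ioi fun y hy => ?_
      have hy' : (0 : ℝ) < y := hy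
      have := Real.cos_le_one τ
      simp only [Function.uncurry]
      rw [Real.norm_of_nonneg (mul_nonneg (by linarith) (by positivity))]
  have hswap := integral_integral_swap hprod
  rw [integral_congr_ae (hae.mono hin), integral_mul_const] at hswap
  have hout : ∫ s in Set.Ioi (0 : ℝ), ∫ τ : ℝ,
      (1 - Real.cos τ) * (s ^ ((1 + α) / 2 - 1) * Real.exp (-(τ ^ 2 * s))) =
      √Real.pi * (Real.Gamma (1 - α / 2) * (1 / 4) ^ (α / 2) / (α / 2)) := by
    rw [← integral_rpow_mul_one_sub_exp (b := α / 2) (l := 1 / 4) (by linarith) (by linarith)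
      (by norm_num), ← integral_comp_rpow_Ioi
        (fun y => y ^ (-(α / 2) - 1) * (1 - Real.exp (-(1 / 4 * y)))) (p := -1) (by norm_num), ← integral_const_mul]
    refine setIntegral_congr_fun measurableSet_Ioi fun s hs => ?_
    have hs' : (0 : ℝ) < s := hs
    have e1 : ∀ τ : ℝ, (1 - Real.cos τ) * (s ^ ((1 + α) / 2 - 1) * Real.exp (-(τ ^ 2 * s))) =
        s ^ ((1 + α) / 2 - 1) * ((1 - Real.cos τ) * Real.exp (-(s * τ ^ 2))) := by
      intro τ; rw [mul_comm (τ ^ 2)]; ring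
    rw [integral_congr_ae (Eventually.of_forall e1), integral_const_mul, integral_one_sub_cos_mul_gaussian hs', Real.rpow_neg_one,
      Real.inv_rpow hs'.le, ← Real.rpow_neg hs'.le, Real.sqrt_div Real.pi_pos.le,
      Real.sqrt_eq_rpow s, smul_eq_mul, abs_neg, abs_one, one_mul]
    rw [show s ^ ((1 + α) / 2 - 1) = s ^ ((-1 - 1 : ℝ)) * s ^ (-(-(α / 2) - 1)) * s ^ (1 / 2 : ℝ) by
      rw [← Real.rpow_add hs', ← Real.rpow_add hs']; congr 1; ring]
    have := (Real.rpow_pos_of_pos hs' (1 / 2)).ne'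
    field_simp
  rw [hout] at hswap
  unfold dConst
  rw [Gamma_neg_half h0]
  have h4 : ((1 : ℝ) / 4) ^ (α / 2) = 2 ^ (-α) := by
    rw [show (1 / 4 : ℝ) = 2 ^ (-2 : ℝ) by rw [Real.rpow_neg zero_le_two]; norm_num,
      ← Real.rpow_mul zero_le_two]
    congr 1; ring
  rw [h4] at hswap
  rw [eq_comm, ← sub_eq_zero]
  field_simp at hswap ⊢
  linarith

/-- The Stein kernel has Fourier symbol `d_α |x|^α`. -/
lemma integral_expKernel {α : ℝ} (h0 : 0 < α) (h1 : α < 1) (x : ℝ) :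
    ∫ τ, expKernel α x τ = ((dConst α * |x| ^ α : ℝ) : ℂ) := by
  rcases eq_or_ne x 0 with rfl | hx
  · simp [expKernel_zero, Real.zero_rpow h0.ne']
  have hI := integrable_expKernel h0 h1 x
  have hneg : ∫ τ, expKernel α x τ = ∫ τ, expKernel α x (-τ) := (integral_neg_eq_self _ _).symm
  have hsum : ∀ τ, expKernel α x τ + expKernel α x (-τ) =
      ((-2 * |x| ^ (1 + α) * ((1 - Real.cos (τ * x)) / |τ * x| ^ (1 + α)) : ℝ) : ℂ) := by
    intro τ
    have h2 : Complex.exp (Complex.I * ((-(τ * x) : ℝ) : ℂ)) +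
        Complex.exp (Complex.I * ((-(-τ * x) : ℝ) : ℂ)) = 2 * ((Real.cos (τ * x) : ℝ) : ℂ) := by
      rw [Complex.ofReal_cos, Complex.cos]
      push_cast
      rw [add_comm]
      have e1 : Complex.I * -(-(τ : ℂ) * x) = τ * x * Complex.I := by ring
      have e2 : Complex.I * -((τ : ℂ) * x) = -(τ * x) * Complex.I := by ring
      rw [e1, e2]; ring
    have h3 : (-2 * |x| ^ (1 + α) * ((1 - Real.cos (τ * x)) / |τ * x| ^ (1 + α)) : ℝ) =
        (2 * Real.cos (τ * x) - 2) / |τ| ^ (1 + α) := by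
      rw [abs_mul, Real.mul_rpow (abs_nonneg _) (abs_nonneg _)]
      have := (Real.rpow_pos_of_pos (abs_pos.2 hx) (1 + α)).ne'
      rcases eq_or_ne (|τ| ^ (1 + α)) 0 with h | h
      · simp [h]
      · field_simp; ring
    rw [h3, expKernel, expKernel, abs_neg, ← add_div]
    push_cast at h2 ⊢
    congr 1
    linear_combination h2
  have h2 : (2 : ℂ) * ∫ τ, expKernel α x τ = 2 * ((dConst α * |x| ^ α : ℝ) : ℂ) := by
    rw [two_mul]
    nth_rewrite 2 [hneg]
    rw [← integral_add hI hI.comp_neg]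
    simp_rw [hsum]
    rw [integral_complex_ofReal, integral_const_mul,
      Measure.integral_comp_mul_right (fun y => (1 - Real.cos y) / |y| ^ (1 + α)),
      integral_one_sub_cos_div h0 h1, Real.rpow_add (abs_pos.2 hx), Real.rpow_one, abs_inv,
      smul_eq_mul]
    have := (abs_pos.2 hx).ne'
    push_cast
    have : ((|x| : ℝ) : ℂ) ≠ 0 := by exact_mod_cast this
    field_simp
  exact mul_left_cancel₀ two_ne_zero h2

/-! ### Integral operators along a coordinate direction -/

lemma measurable_shift (j : Fin 2) : Measurable fun p : Plane × ℝ => shift j p.1 p.2 := by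
  unfold shift; fun_prop

lemma measurable_shift_right (j : Fin 2) (ζ : Plane) : Measurable fun τ : ℝ => shift j ζ τ := by
  unfold shift; fun_prop

lemma measurePreserving_shift (j : Fin 2) (τ : ℝ) :
    MeasurePreserving (fun ζ : Plane => shift j ζ τ) volume volume :=
  measurePreserving_add_right _ _

lemma lintegral_mul_sq_le {X : Type*} [MeasurableSpace X] (μ : Measure X) {a b : X → ℝ≥0∞}
    (ha : AEMeasurable a μ) (hb : AEMeasurable b μ) :
    (∫⁻ x, a x * b x ∂μ) ^ 2 ≤ (∫⁻ x, a x ^ 2 ∂μ) * ∫⁻ x, b x ^ 2 ∂μ := by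
  have h := ENNReal.lintegral_mul_le_Lp_mul_Lq μ Real.HolderConjugate.two_two ha hb
  simp only [Pi.mul_apply, ENNReal.rpow_two] at h
  calc _ ≤ ((∫⁻ x, a x ^ 2 ∂μ) ^ (1 / 2 : ℝ) * (∫⁻ x, b x ^ 2 ∂μ) ^ (1 / 2 : ℝ)) ^ 2 := by gcongr
    _ = _ := by
      rw [mul_pow, ← ENNReal.rpow_two, ← ENNReal.rpow_two, ← ENNReal.rpow_mul, ← ENNReal.rpow_mul]
      norm_num

lemma norm2_sq (F : Plane → ℂ) : norm2 F ^ 2 = ∫⁻ x, ‖F x‖ₑ ^ 2 := by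
  rw [norm2, eLpNorm_eq_lintegral_rpow_enorm_toReal two_ne_zero ENNReal.ofNat_ne_top, ← ENNReal.rpow_two,
    ← ENNReal.rpow_mul]
  simp

lemma memLp_two_of_enorm_le {F : Plane → ℂ} {G : Plane → ℝ≥0∞}
    (hF : AEStronglyMeasurable F volume) (hG : ∫⁻ x, G x ^ 2 < ∞)
    (h : ∀ᵐ x, ‖F x‖ₑ ≤ G x) : MemLp F 2 volume := by
  refine ⟨hF, ?_⟩
  change norm2 F < ∞
  have : norm2 F ^ 2 < ∞ := by
    rw [norm2_sq]
    refine lt_of_le_of_lt (lintegral_mono_ae ?_) hG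
    filter_upwards [h] with x hx
    gcongr
  by_contra hc
  rw [not_lt, top_le_iff] at hc
  simp [hc] at this

/-- Schur's test with weight `w`, for integral operators which integrate over a line parallel to a
coordinate axis and whose kernel depends on the end point and on the increment. -/
lemma lintegral_sq_lintegral_shift_le (j : Fin 2) {L : Plane → ℝ → ℝ≥0∞}
    (hL : Measurable (Function.uncurry L)) {w h : Plane → ℝ≥0∞} (hw : Measurable w)
    (hw0 : ∀ ζ, w ζ ≠ 0) (hwt : ∀ ζ, w ζ ≠ ∞) (hh : Measurable h) {A B : ℝ≥0∞}
    (hA : ∀ ζ, ∫⁻ τ, L (shift j ζ τ) τ * (w (shift j ζ τ))⁻¹ ≤ A)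
    (hB : ∀ ζ, ∫⁻ τ, L ζ τ ≤ B * w ζ) :
    ∫⁻ ζ, (∫⁻ τ, L (shift j ζ τ) τ * h (shift j ζ τ)) ^ 2 ≤
      A * (B * ∫⁻ ζ, w ζ ^ 2 * h ζ ^ 2) := by
  have hL' : Measurable fun p : Plane × ℝ => L (shift j p.1 p.2) p.2 :=
    hL.comp ((measurable_shift j).prodMk measurable_snd)
  have hLζ : ∀ ζ, Measurable fun τ : ℝ => L (shift j ζ τ) τ := fun ζ =>
    hL'.comp measurable_prodMk_left
  have hsq : ∀ a : ℝ≥0∞, (a ^ (1 / 2 : ℝ)) ^ 2 = a := by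
    intro a
    rw [← ENNReal.rpow_two, ← ENNReal.rpow_mul]; norm_num
  have hCS : ∀ ζ, (∫⁻ τ, L (shift j ζ τ) τ * h (shift j ζ τ)) ^ 2 ≤
      A * ∫⁻ τ, L (shift j ζ τ) τ * (w (shift j ζ τ) * h (shift j ζ τ) ^ 2) := by
    intro ζ
    have hwζ := hw.comp (measurable_shift_right j ζ)
    have hhζ := hh.comp (measurable_shift_right j ζ)
    simp only [Function.comp_def] at hwζ hhζ
    have e : ∀ τ, L (shift j ζ τ) τ * h (shift j ζ τ) =
        (L (shift j ζ τ) τ * (w (shift j ζ τ))⁻¹) ^ (1 / 2 : ℝ) *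
        (L (shift j ζ τ) τ * (w (shift j ζ τ) * h (shift j ζ τ) ^ 2)) ^ (1 / 2 : ℝ) := by
      intro τ
      rw [← ENNReal.mul_rpow_of_nonneg _ _ (by norm_num)]
      have : L (shift j ζ τ) τ * (w (shift j ζ τ))⁻¹ *
          (L (shift j ζ τ) τ * (w (shift j ζ τ) * h (shift j ζ τ) ^ 2)) =
          (L (shift j ζ τ) τ * h (shift j ζ τ)) ^ 2 := by
        have h1 := ENNReal.inv_mul_cancel (hw0 (shift j ζ τ)) (hwt (shift j ζ τ))
        calc _ = ((w (shift j ζ τ))⁻¹ * w (shift j ζ τ)) *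
              (L (shift j ζ τ) τ * h (shift j ζ τ)) ^ 2 := by ring
          _ = _ := by rw [h1, one_mul]
      rw [this, ← ENNReal.rpow_two, ← ENNReal.rpow_mul]
      norm_num
    simp_rw [e]
    refine (lintegral_mul_sq_le _ (((hLζ ζ).mul hwζ.inv).pow_const _).aemeasurable
      (((hLζ ζ).mul (hwζ.mul (hhζ.pow_const 2))).pow_const _).aemeasurable).trans ?_
    simp_rw [hsq]
    exact mul_le_mul_left (hA ζ) _
  calc _ ≤ ∫⁻ ζ, A * ∫⁻ τ, L (shift j ζ τ) τ * (w (shift j ζ τ) * h (shift j ζ τ) ^ 2) :=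
        lintegral_mono hCS
    _ = A * ∫⁻ ζ, ∫⁻ τ, L (shift j ζ τ) τ * (w (shift j ζ τ) * h (shift j ζ τ) ^ 2) := by
        refine lintegral_const_mul _ ?_
        refine Measurable.lintegral_prod_right' (f := fun p : Plane × ℝ =>
          L (shift j p.1 p.2) p.2 * (w (shift j p.1 p.2) * h (shift j p.1 p.2) ^ 2)) ?_
        exact hL'.mul ((hw.comp (measurable_shift j)).mul ((hh.comp (measurable_shift j)).pow_const 2))
    _ = A * ∫⁻ τ, ∫⁻ ζ, L (shift j ζ τ) τ * (w (shift j ζ τ) * h (shift j ζ τ) ^ 2) := by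
        congr 1
        refine lintegral_lintegral_swap (Measurable.aemeasurable ?_)
        exact hL'.mul ((hw.comp (measurable_shift j)).mul ((hh.comp (measurable_shift j)).pow_const 2))
    _ = A * ∫⁻ τ, ∫⁻ ζ, L ζ τ * (w ζ * h ζ ^ 2) := by
        congr 1
        refine lintegral_congr fun τ => ?_
        have hm : Measurable fun ζ => L ζ τ * (w ζ * h ζ ^ 2) :=
          (hL.comp measurable_prodMk_right).mul (hw.mul (hh.pow_const 2))
        exact (measurePreserving_shift j τ).lintegral_comp hm
    _ = A * ∫⁻ ζ, ∫⁻ τ, L ζ τ * (w ζ * h ζ ^ 2) := by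
        congr 1
        refine (lintegral_lintegral_swap (Measurable.aemeasurable ?_)).symm
        exact hL.mul ((hw.comp measurable_fst).mul ((hh.comp measurable_fst).pow_const 2))
    _ ≤ A * ∫⁻ ζ, B * (w ζ ^ 2 * h ζ ^ 2) := by
        gcongr with ζ
        have hLζ' : Measurable fun τ => L ζ τ := hL.comp measurable_prodMk_left
        rw [lintegral_mul_const _ hLζ']
        calc _ ≤ B * w ζ * (w ζ * h ζ ^ 2) := by gcongr; exact hB ζ
          _ = _ := by ring
    _ = _ := by
        rw [lintegral_const_mul _ (by fun_prop)]

/-- Convolution with the kernel `k` along the `j`-th coordinate axis. -/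
noncomputable def lineConv (j : Fin 2) (k : ℝ → ℂ) (g : Plane → ℂ) (ζ : Plane) : ℂ :=
  ∫ τ, k τ * g (shift j ζ τ)

lemma lintegral_sq_lineConv_lt_top (j : Fin 2) {k : ℝ → ℂ} (hk : Integrable k)
    (hkm : Measurable k) {g : Plane → ℂ} (hgm : Measurable g) (hg : MemLp g 2 volume) :
    ∫⁻ ζ, (∫⁻ τ, ‖k τ‖ₑ * ‖g (shift j ζ τ)‖ₑ) ^ 2 < ∞ := by
  have hfin : ∫⁻ τ, ‖k τ‖ₑ < ∞ := hk.2
  refine (lintegral_sq_lintegral_shift_le j (L := fun _ τ => ‖k τ‖ₑ) (w := fun _ => 1)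
    (h := fun ζ => ‖g ζ‖ₑ) (A := ∫⁻ τ, ‖k τ‖ₑ) (B := ∫⁻ τ, ‖k τ‖ₑ)
    (hkm.enorm.comp measurable_snd) measurable_const (by simp) (by simp) hgm.enorm
    (by simp) (by simp)).trans_lt ?_
  have h2 : ∫⁻ ζ, ‖g ζ‖ₑ ^ 2 < ∞ := by
    rw [← norm2_sq]; exact ENNReal.pow_lt_top hg.2
  simp only [one_pow, one_mul]
  exact ENNReal.mul_lt_top hfin (ENNReal.mul_lt_top hfin h2)

lemma measurable_lineConv_integrand (j : Fin 2) {k : ℝ → ℂ} (hkm : Measurable k)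
    {g : Plane → ℂ} (hgm : Measurable g) :
    Measurable fun p : Plane × ℝ => k p.2 * g (shift j p.1 p.2) :=
  (hkm.comp measurable_snd).mul (hgm.comp (measurable_shift j))

lemma ae_integrable_lineConv (j : Fin 2) {k : ℝ → ℂ} (hk : Integrable k)
    (hkm : Measurable k) {g : Plane → ℂ} (hgm : Measurable g) (hg : MemLp g 2 volume) :
    ∀ᵐ ζ : Plane, Integrable fun τ => k τ * g (shift j ζ τ) := by
  have hm := measurable_lineConv_integrand j hkm hgm
  have h := ae_lt_top (μ := (volume : Measure Plane))
    (f := fun ζ => (∫⁻ τ, ‖k τ‖ₑ * ‖g (shift j ζ τ)‖ₑ) ^ 2) ?_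
    (lintegral_sq_lineConv_lt_top j hk hkm hgm hg).ne
  · filter_upwards [h] with ζ hζ
    refine ⟨(hm.comp measurable_prodMk_left).aestronglyMeasurable, ?_⟩
    unfold HasFiniteIntegral
    simp_rw [enorm_mul]
    by_contra hc
    rw [not_lt, top_le_iff] at hc
    simp [hc] at hζ
  · refine Measurable.pow_const ?_ 2
    have := hm.enorm.lintegral_prod_right' (ν := (volume : Measure ℝ))
    simpa [enorm_mul] using this

lemma memLp_lineConv (j : Fin 2) {k : ℝ → ℂ} (hk : Integrable k)
    (hkm : Measurable k) {g : Plane → ℂ} (hgm : Measurable g) (hg : MemLp g 2 volume) :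
    MemLp (lineConv j k g) 2 volume := by
  have hm := measurable_lineConv_integrand j hkm hgm
  refine memLp_two_of_enorm_le ?_ (lintegral_sq_lineConv_lt_top j hk hkm hgm hg)
    (Eventually.of_forall fun ζ => ?_)
  · exact (hm.stronglyMeasurable.integral_prod_right' (ν := (volume : Measure ℝ))).aestronglyMeasurable
  · refine (enorm_integral_le_lintegral_enorm _).trans ?_
    simp_rw [enorm_mul]; rfl

lemma inner_single_smul (j : Fin 2) (τ : ℝ) (x : Plane) :
    inner ℝ (τ • EuclideanSpace.single j (1 : ℝ)) x = τ * x j := by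
  rw [real_inner_smul_left, EuclideanSpace.inner_single_left]
  simp

lemma fourierInv_comp_shift (j : Fin 2) (τ : ℝ) {g : Plane → ℂ} (hg : MemLp g 2 volume) :
    fourierInv (fun x => g (shift j x τ)) =ᵐ[volume]
      fun x => Complex.exp (Complex.I * ((-(τ * x j) : ℝ) : ℂ)) * fourierInv g x := by
  filter_upwards [fourierInv_comp_add (τ • EuclideanSpace.single j (1 : ℝ)) hg] with x hx
  refine hx.trans ?_
  rw [inner_single_smul]
  congr 2
  push_cast; ring

/-- The inverse Fourier transform turns convolution along a coordinate axis into multiplication by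
the one-dimensional Fourier transform of the kernel. -/
lemma fourierInv_lineConv (j : Fin 2) {k : ℝ → ℂ} (hk : Integrable k)
    (hkm : Measurable k) {g : Plane → ℂ} (hgm : Measurable g) (hg : MemLp g 2 volume) :
    fourierInv (lineConv j k g) =ᵐ[volume]
      fun x => (∫ τ, k τ * Complex.exp (Complex.I * ((-(τ * x j) : ℝ) : ℂ))) * fourierInv g x := by
  have hm := measurable_lineConv_integrand j hkm hgm
  have hC := memLp_lineConv j hk hkm hgm hg
  have he : Measurable fun p : Plane × ℝ =>
      Complex.exp (Complex.I * ((-(p.2 * p.1 j) : ℝ) : ℂ)) := by fun_prop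
  have hke : Measurable fun p : Plane × ℝ =>
      k p.2 * Complex.exp (Complex.I * ((-(p.2 * p.1 j) : ℝ) : ℂ)) :=
    (hkm.comp measurable_snd).mul he
  have hB : MemLp (fun x => (∫ τ, k τ * Complex.exp (Complex.I * ((-(τ * x j) : ℝ) : ℂ))) *
      fourierInv g x) 2 volume := by
    refine ((memLp_fourierInv g).const_mul ((∫ τ, ‖k τ‖ : ℝ) : ℂ)).mono ?_
      (Eventually.of_forall fun x => ?_)
    · exact (hke.stronglyMeasurable.integral_prod_right'
        (ν := (volume : Measure ℝ))).aestronglyMeasurable.mul (memLp_fourierInv g).1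
    · rw [norm_mul, norm_mul]
      gcongr
      rw [Complex.norm_real]
      refine (norm_integral_le_integral_norm _).trans ((le_of_eq ?_).trans (le_abs_self _))
      simp_rw [norm_mul, Complex.norm_exp_I_mul_ofReal, mul_one]
  refine ae_eq_of_integral_conj_mul_eq (memLp_fourierInv _) hB fun H hH => ?_
  rw [integral_conj_mul_fourierInv hH hC]
  have hHf := memLp_fourier H
  have hHm := measurable_fourier H
  have hshift : ∀ τ, MemLp (fun ζ => g (shift j ζ τ)) 2 volume := fun τ =>
    hg.comp_measurePreserving (measurePreserving_shift j τ)
  have hint1 : Integrable (Function.uncurry fun (ζ : Plane) (τ : ℝ) =>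
      conj (fourier H ζ) * (k τ * g (shift j ζ τ)))
      ((volume : Measure Plane).prod (volume : Measure ℝ)) := by
    have hm1 : Measurable (Function.uncurry fun (ζ : Plane) (τ : ℝ) =>
        conj (fourier H ζ) * (k τ * g (shift j ζ τ))) :=
      (Complex.continuous_conj.measurable.comp (hHm.comp measurable_fst)).mul hm
    rw [integrable_prod_iff hm1.aestronglyMeasurable]
    constructor
    · filter_upwards [ae_integrable_lineConv j hk hkm hgm hg] with ζ hζ
      exact hζ.const_mul (conj (fourier H ζ))
    · have h1 := memLp_lineConv j hk.norm.ofReal (by fun_prop)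
        (g := fun ζ => ((‖g ζ‖ : ℝ) : ℂ)) (by fun_prop) hg.norm.ofReal
      refine (hHf.norm.integrable_mul h1.norm).congr (Eventually.of_forall fun ζ => ?_)
      simp only [Pi.mul_apply, Function.uncurry, norm_mul, RCLike.norm_conj]
      rw [integral_const_mul, lineConv]
      congr 1
      have : ∀ τ, ((‖k τ‖ : ℝ) : ℂ) * ((‖g (shift j ζ τ)‖ : ℝ) : ℂ) =
          ((‖k τ‖ * ‖g (shift j ζ τ)‖ : ℝ) : ℂ) := fun τ => by push_cast; rfl
      refine (congrArg norm (integral_congr_ae (Eventually.of_forall this))).trans ?_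
      rw [integral_complex_ofReal, Complex.norm_real, Real.norm_of_nonneg]
      exact integral_nonneg fun τ => by positivity
  have hint2 : Integrable (Function.uncurry fun (x : Plane) (τ : ℝ) =>
      conj (H x) * ((k τ * Complex.exp (Complex.I * ((-(τ * x j) : ℝ) : ℂ))) * fourierInv g x))
      ((volume : Measure Plane).prod (volume : Measure ℝ)) := by
    have h1 : Integrable fun x => conj (H x) * fourierInv g x :=
      hH.star.integrable_mul (memLp_fourierInv g)
    have h2 := (h1.mul_prod hk).bdd_mul (c := 1) he.aestronglyMeasurable
      (Eventually.of_forall fun p => (Complex.norm_exp_I_mul_ofReal _).le)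
    refine h2.congr (Eventually.of_forall fun p => ?_)
    simp only [Function.uncurry]
    ring
  calc ∫ ζ, conj (fourier H ζ) * lineConv j k g ζ
      = ∫ ζ, ∫ τ, conj (fourier H ζ) * (k τ * g (shift j ζ τ)) := by
        simp_rw [lineConv, integral_const_mul]
    _ = ∫ τ, ∫ ζ, conj (fourier H ζ) * (k τ * g (shift j ζ τ)) := integral_integral_swap hint1
    _ = ∫ τ, ∫ x, conj (H x) *
          ((k τ * Complex.exp (Complex.I * ((-(τ * x j) : ℝ) : ℂ))) * fourierInv g x) := by
        congr 1; ext τ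
        have e1 : ∀ ζ, conj (fourier H ζ) * (k τ * g (shift j ζ τ)) =
            k τ * (conj (fourier H ζ) * g (shift j ζ τ)) := fun ζ => by ring
        simp_rw [e1]
        rw [integral_const_mul, ← integral_conj_mul_fourierInv hH (hshift τ), ← integral_const_mul]
        apply integral_congr_ae
        filter_upwards [fourierInv_comp_shift j τ hg] with x hx
        rw [hx]; ring
    _ = ∫ x, ∫ τ, conj (H x) *
          ((k τ * Complex.exp (Complex.I * ((-(τ * x j) : ℝ) : ℂ))) * fourierInv g x) :=
        (integral_integral_swap hint2).symm
    _ = _ := by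
        simp_rw [integral_const_mul, integral_mul_const]

/-! ### Weighted estimates for `Φ` -/

/-- The weight `1 + |ζ|²`. -/
noncomputable def wt (ζ : Plane) : ℝ := 1 + ‖ζ‖ ^ 2

lemma one_le_wt (ζ : Plane) : 1 ≤ wt ζ := by unfold wt; nlinarith [sq_nonneg ‖ζ‖]

lemma wt_pos (ζ : Plane) : 0 < wt ζ := one_pos.trans_le (one_le_wt ζ)

lemma measurable_wt : Measurable wt := by unfold wt; fun_prop

lemma wt_eq (ζ : Plane) : wt ζ = 1 + ζ 0 ^ 2 + ζ 1 ^ 2 := by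
  rw [wt, EuclideanSpace.norm_sq_eq, Fin.sum_univ_two]
  simp [add_assoc]

lemma shift_zero_apply_zero (ζ : Plane) (τ : ℝ) : shift 0 ζ τ 0 = ζ 0 + τ := by simp [shift]
lemma shift_zero_apply_one (ζ : Plane) (τ : ℝ) : shift 0 ζ τ 1 = ζ 1 := by simp [shift]
lemma shift_one_apply_zero (ζ : Plane) (τ : ℝ) : shift 1 ζ τ 0 = ζ 0 := by simp [shift]
lemma shift_one_apply_one (ζ : Plane) (τ : ℝ) : shift 1 ζ τ 1 = ζ 1 + τ := by simp [shift]

lemma shift_shift_neg (j : Fin 2) (ζ : Plane) (τ : ℝ) : shift j (shift j ζ τ) (-τ) = ζ := by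
  simp [shift]

lemma wt_shift_le (j : Fin 2) (ζ : Plane) (τ : ℝ) :
    wt (shift j ζ τ) ≤ 3 * (wt ζ * max 1 |τ| ^ 2) := by
  have h1 : ‖shift j ζ τ‖ ≤ ‖ζ‖ + |τ| := by
    refine (norm_add_le _ _).trans ?_
    simp [norm_smul]
  have h2 := le_max_left 1 |τ|
  have h3 := le_max_right 1 |τ|
  unfold wt
  set m := max 1 |τ|
  have h4 : ‖shift j ζ τ‖ ^ 2 ≤ (‖ζ‖ + |τ|) ^ 2 := by gcongr
  have h5 : |τ| ^ 2 ≤ m ^ 2 := by gcongr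
  have h6 : 1 ≤ m ^ 2 := one_le_pow₀ h2
  nlinarith [sq_nonneg (‖ζ‖ - |τ|), mul_le_mul_of_nonneg_left h6 (sq_nonneg ‖ζ‖)]

lemma wt_le_shift (j : Fin 2) (ζ : Plane) (τ : ℝ) :
    wt ζ ≤ 3 * (wt (shift j ζ τ) * max 1 |τ| ^ 2) := by
  have := wt_shift_le j (shift j ζ τ) (-τ)
  rwa [shift_shift_neg, abs_neg] at this

lemma abs_phase_shift_sub_le (j : Fin 2) (ζ : Plane) (τ : ℝ) :
    |phase (shift j ζ τ) - phase ζ| ≤ 5 * (|τ| * (wt (shift j ζ τ) + τ ^ 2)) := by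
  obtain ⟨p, hp⟩ : ∃ p, p = shift j ζ τ := ⟨_, rfl⟩
  have hζ : ζ = shift j p (-τ) := by rw [hp, shift_shift_neg]
  rw [← hp, wt_eq, hζ]
  have key : ∃ q, phase p - phase (shift j p (-τ)) = τ * q ∧
      |q| ≤ 5 * (1 + p 0 ^ 2 + p 1 ^ 2 + τ ^ 2) := by
    fin_cases j
    · refine ⟨3 * p 0 ^ 2 - 3 * p 0 * τ + τ ^ 2 + p 1 ^ 2, ?_, ?_⟩
      · simp only [Fin.zero_eta, phase, shift_zero_apply_zero, shift_zero_apply_one]; ring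
      · rw [abs_le]
        constructor <;> nlinarith [sq_nonneg (p 0 - τ), sq_nonneg (p 0 + τ), sq_nonneg (p 1),
          sq_nonneg τ, sq_nonneg (p 0)]
    · refine ⟨p 0 * (2 * p 1 - τ), ?_, ?_⟩
      · simp only [Fin.mk_one, phase, shift_one_apply_zero, shift_one_apply_one]; ring
      · rw [abs_le]
        constructor <;> nlinarith [sq_nonneg (p 0 - τ), sq_nonneg (p 0 + τ), sq_nonneg (p 1),
          sq_nonneg τ, sq_nonneg (p 0), sq_nonneg (p 0 - p 1), sq_nonneg (p 0 + p 1)]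
  obtain ⟨q, h1, h2⟩ := key
  rw [h1, abs_mul]
  calc |τ| * |q| ≤ |τ| * (5 * (1 + p 0 ^ 2 + p 1 ^ 2 + τ ^ 2)) := by gcongr
    _ = _ := by ring

lemma norm_phiIntegrand_le (j : Fin 2) (t α : ℝ) (f : Plane → ℂ) (ζ : Plane) (τ : ℝ) :
    ‖phiIntegrand j t α f ζ τ‖ ≤
      20 * (1 + |t|) * (kern α (wt (shift j ζ τ)) τ * ‖f (shift j ζ τ)‖) := by
  set M := wt (shift j ζ τ) with hM
  have hM1 : 1 ≤ M := one_le_wt _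
  have hΔ := abs_phase_shift_sub_le j ζ τ
  rw [← hM] at hΔ
  have hmin : min 1 |t * (phase (shift j ζ τ) - phase ζ)| ≤ 10 * (1 + |t|) * min 1 (|τ| * M) := by
    have ht := abs_nonneg t
    rcases le_total 1 (|τ| * M) with h | h
    · rw [min_eq_left h]
      refine (min_le_left _ _).trans ?_
      linarith
    · rw [min_eq_right h, abs_mul]
      refine (min_le_right _ _).trans ?_
      have hτ1 : |τ| ≤ 1 := by nlinarith [abs_nonneg τ]
      have hτ2 : τ ^ 2 ≤ M := by rw [← sq_abs]; nlinarith [abs_nonneg τ]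
      calc |t| * |phase (shift j ζ τ) - phase ζ| ≤ |t| * (5 * (|τ| * (M + τ ^ 2))) := by gcongr
        _ ≤ (1 + |t|) * (5 * (|τ| * (M + M))) := by gcongr; linarith
        _ = _ := by ring
  unfold phiIntegrand kern
  rw [norm_mul, norm_div, Complex.norm_real, Real.norm_of_nonneg (by positivity), ← mul_assoc]
  gcongr
  rw [← mul_div_assoc]
  gcongr
  refine (norm_exp_I_mul_sub_one_le _).trans ?_
  linarith

/-- Pointwise majorant of `Φ`: the integral of the kernel `kern α` against `|f|`. -/
noncomputable def phiMajorant (j : Fin 2) (α : ℝ) (f : Plane → ℂ) (ζ : Plane) : ℝ≥0∞ :=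
  ∫⁻ τ, ENNReal.ofReal (kern α (wt (shift j ζ τ)) τ) * ‖f (shift j ζ τ)‖ₑ

lemma measurable_kern_wt (α : ℝ) :
    Measurable fun p : Plane × ℝ => kern α (wt p.1) p.2 :=
  (measurable_kern α).comp ((measurable_wt.comp measurable_fst).prodMk measurable_snd)

lemma measurable_kern_wt_shift (j : Fin 2) (α : ℝ) :
    Measurable fun p : Plane × ℝ => kern α (wt (shift j p.1 p.2)) p.2 :=
  (measurable_kern_wt α).comp ((measurable_shift j).prodMk measurable_snd)

lemma measurable_phiMajorant (j : Fin 2) (α : ℝ) {f : Plane → ℂ} (hf : Measurable f) :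
    Measurable (phiMajorant j α f) :=
  Measurable.lintegral_prod_right' (f := fun p : Plane × ℝ =>
      ENNReal.ofReal (kern α (wt (shift j p.1 p.2)) p.2) * ‖f (shift j p.1 p.2)‖ₑ)
    ((measurable_kern_wt_shift j α).ennreal_ofReal.mul (hf.comp (measurable_shift j)).enorm)

/-- For increments beyond `1` the kernel decays like `|τ|^{-1-α}`, so that it absorbs a growth
`|τ|^β` with `β < α`. -/
lemma kern_mul_rpow_le_of_one_le {α β M τ : ℝ} (hτ : 1 ≤ |τ|) :
    kern α M τ * max 1 |τ| ^ β ≤ kern (α - β) 1 τ := by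
  have h0 : 0 < |τ| := one_pos.trans_le hτ
  unfold kern
  rw [max_eq_right hτ, mul_one, min_eq_left hτ, show 1 + (α - β) = (1 + α) - β by ring,
    Real.rpow_sub h0, one_div_div, div_mul_eq_mul_div]
  gcongr
  exact mul_le_of_le_one_left (by positivity) (min_le_left _ _)

lemma kern_mono {α M N : ℝ} (h : M ≤ N) (τ : ℝ) : kern α M τ ≤ kern α N τ := by
  unfold kern; gcongr

lemma kern_mul_rpow_le {α β M : ℝ} (hM : 0 ≤ M) (τ : ℝ) :
    kern α M τ * max 1 |τ| ^ β ≤ kern α M τ + kern (α - β) 1 τ := by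
  rcases le_total 1 |τ| with h | h
  · linarith [kern_mul_rpow_le_of_one_le (α := α) (β := β) (M := M) h, kern_nonneg (α := α) hM τ]
  · rw [max_eq_left h, Real.one_rpow, mul_one]
    linarith [kern_nonneg (α := α - β) zero_le_one τ]

lemma lintegral_kern_mul_rpow_le {α β : ℝ} (hα : α < 1) (hβ0 : 0 ≤ β) (hβ : β < α) (ζ : Plane) :
    ∫⁻ τ, ENNReal.ofReal (kern α (wt ζ) τ * max 1 |τ| ^ β) ≤
      ENNReal.ofReal ((∫ τ, kern α 1 τ) + ∫ τ, kern (α - β) 1 τ) *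
        ENNReal.ofReal (wt ζ ^ α) := by
  have hα0 : 0 < α := hβ0.trans_lt hβ
  have i1 := integrable_kern hα0 hα (wt_pos ζ)
  have i2 := integrable_kern_one (α := α - β) (by linarith) (by linarith)
  have p1 : 0 ≤ ∫ τ, kern α 1 τ := integral_nonneg (kern_nonneg zero_le_one)
  have p2 : 0 ≤ ∫ τ, kern (α - β) 1 τ := integral_nonneg (kern_nonneg zero_le_one)
  calc _ ≤ ∫⁻ τ, ENNReal.ofReal (kern α (wt ζ) τ + kern (α - β) 1 τ) :=
        lintegral_mono fun τ => ENNReal.ofReal_le_ofReal (kern_mul_rpow_le (wt_pos ζ).le τ)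
    _ = ENNReal.ofReal (∫ τ, (kern α (wt ζ) τ + kern (α - β) 1 τ)) :=
        (ofReal_integral_eq_lintegral_ofReal (i1.add i2) (Eventually.of_forall fun τ =>
          add_nonneg (kern_nonneg (wt_pos ζ).le τ) (kern_nonneg zero_le_one τ))).symm
    _ ≤ _ := by
        rw [← ENNReal.ofReal_mul (by positivity), integral_add i1 i2, integral_kern (wt_pos ζ)]
        apply ENNReal.ofReal_le_ofReal
        have : 1 ≤ wt ζ ^ α := Real.one_le_rpow (one_le_wt ζ) hα0.le
        nlinarith

lemma lintegral_kern_shift_mul_rpow_le (j : Fin 2) {α β : ℝ} (hα : α < 1) (hβ0 : 0 ≤ β)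
    (hβ : β < α) (ζ : Plane) :
    ∫⁻ τ, ENNReal.ofReal (kern α (wt (shift j ζ τ)) τ * max 1 |τ| ^ β) *
        (ENNReal.ofReal (wt (shift j ζ τ) ^ α))⁻¹ ≤
      ENNReal.ofReal (9 * (∫ τ, kern α 1 τ) + ∫ τ, kern (α - β) 1 τ) := by
  have hα0 : 0 < α := hβ0.trans_lt hβ
  have hM := wt_pos ζ
  have hMα := Real.rpow_pos_of_pos hM α
  have i1 := (integrable_kern hα0 hα (by positivity : 0 < 3 * wt ζ)).const_mul (3 ^ α / wt ζ ^ α)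
  have i2 := integrable_kern_one (α := α - β) (by linarith) (by linarith)
  have p1 : 0 ≤ ∫ τ, kern α 1 τ := integral_nonneg (kern_nonneg zero_le_one)
  have hpt : ∀ τ, kern α (wt (shift j ζ τ)) τ * max 1 |τ| ^ β * (wt (shift j ζ τ) ^ α)⁻¹ ≤
      3 ^ α / wt ζ ^ α * kern α (3 * wt ζ) τ + kern (α - β) 1 τ := by
    intro τ
    have hM' := wt_pos (shift j ζ τ)
    have hk0 := kern_nonneg (α := α) hM'.le τ
    rcases le_total 1 |τ| with h | h
    · have h1 := kern_mul_rpow_le_of_one_le (α := α) (β := β) (M := wt (shift j ζ τ)) h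
      have h2 : (wt (shift j ζ τ) ^ α)⁻¹ ≤ 1 :=
        inv_le_one_of_one_le₀ (Real.one_le_rpow (one_le_wt _) hα0.le)
      have h3 : kern α (wt (shift j ζ τ)) τ * max 1 |τ| ^ β * (wt (shift j ζ τ) ^ α)⁻¹ ≤
          kern α (wt (shift j ζ τ)) τ * max 1 |τ| ^ β :=
        mul_le_of_le_one_right (by positivity) h2
      have h4 : 0 ≤ 3 ^ α / wt ζ ^ α * kern α (3 * wt ζ) τ :=
        mul_nonneg (by positivity) (kern_nonneg (by positivity) τ)
      linarith
    · have e1 := wt_shift_le j ζ τ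
      have e2 := wt_le_shift j ζ τ
      rw [max_eq_left h] at e1 e2 ⊢
      rw [Real.one_rpow, mul_one]
      simp only [one_pow, mul_one] at e1 e2
      have h1 : kern α (wt (shift j ζ τ)) τ ≤ kern α (3 * wt ζ) τ := kern_mono e1 τ
      have h2 : (wt (shift j ζ τ) ^ α)⁻¹ ≤ 3 ^ α / wt ζ ^ α := by
        rw [← Real.div_rpow (by norm_num) hM.le, ← Real.inv_rpow hM'.le]
        apply Real.rpow_le_rpow (by positivity) _ hα0.le
        rw [inv_eq_one_div, div_le_div_iff₀ hM' hM]
        linarith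
      have h3 := kern_nonneg (α := α - β) zero_le_one τ
      have h4 := mul_le_mul h1 h2 (by positivity) (hk0.trans h1)
      linarith
  calc _ ≤ ∫⁻ τ, ENNReal.ofReal (3 ^ α / wt ζ ^ α * kern α (3 * wt ζ) τ + kern (α - β) 1 τ) := by
        refine lintegral_mono fun τ => ?_
        have hM' := wt_pos (shift j ζ τ)
        rw [← ENNReal.ofReal_inv_of_pos (Real.rpow_pos_of_pos hM' α),
          ← ENNReal.ofReal_mul (mul_nonneg (kern_nonneg hM'.le τ) (by positivity))]
        exact ENNReal.ofReal_le_ofReal (hpt τ)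
    _ = ENNReal.ofReal (∫ τ, (3 ^ α / wt ζ ^ α * kern α (3 * wt ζ) τ + kern (α - β) 1 τ)) :=
        (ofReal_integral_eq_lintegral_ofReal (i1.add i2) (Eventually.of_forall fun τ =>
          add_nonneg (mul_nonneg (by positivity) (kern_nonneg (by positivity) τ))
            (kern_nonneg zero_le_one τ))).symm
    _ ≤ _ := by
        rw [integral_add i1 i2, integral_const_mul, integral_kern (by positivity)]
        apply ENNReal.ofReal_le_ofReal
        rw [Real.mul_rpow (by norm_num) hM.le]
        have h9 : (3 : ℝ) ^ α * 3 ^ α ≤ 9 := by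
          rw [← Real.mul_rpow (by norm_num) (by norm_num)]
          calc ((3 : ℝ) * 3) ^ α ≤ (3 * 3) ^ (1 : ℝ) :=
                Real.rpow_le_rpow_of_exponent_le (by norm_num) hα.le
            _ = 9 := by norm_num
        have : (3 : ℝ) ^ α / wt ζ ^ α * (3 ^ α * wt ζ ^ α * ∫ τ, kern α 1 τ) =
            3 ^ α * 3 ^ α * ∫ τ, kern α 1 τ := by
          field_simp
        rw [this]
        gcongr

/-- Weighted `L²` bound for the majorant. Schur's test applies because the kernel at a point of
weight `M` has mass `O(M^α)`, and the weights of points at distance at most `1` are comparable. -/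
lemma exists_lintegral_phiMajorant_le {α β : ℝ} (hα : α < 1) (hβ0 : 0 ≤ β) (hβ : β < α) :
    ∃ C : ℝ, 0 < C ∧ ∀ (j : Fin 2) (f : Plane → ℂ), Measurable f →
      ∫⁻ ζ, (ENNReal.ofReal (wt ζ ^ (β / 2)) * phiMajorant j α f ζ) ^ 2 ≤
        ENNReal.ofReal (C ^ 2) * ∫⁻ ζ, (ENNReal.ofReal (wt ζ ^ (α + β / 2)) * ‖f ζ‖ₑ) ^ 2 := by
  have hα0 : 0 < α := hβ0.trans_lt hβ
  set B := (∫ τ, kern α 1 τ) + ∫ τ, kern (α - β) 1 τ with hB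
  set A := 9 * (∫ τ, kern α 1 τ) + ∫ τ, kern (α - β) 1 τ with hA
  have p1 : 0 ≤ ∫ τ, kern α 1 τ := integral_nonneg (kern_nonneg zero_le_one)
  have p2 : 0 ≤ ∫ τ, kern (α - β) 1 τ := integral_nonneg (kern_nonneg zero_le_one)
  have hA0 : 0 ≤ A := by positivity
  have hB0 : 0 ≤ B := by positivity
  refine ⟨3 * (A + B + 1), by positivity, fun j f hf => ?_⟩
  set h : Plane → ℝ≥0∞ := fun ζ => ENNReal.ofReal (wt ζ ^ (β / 2)) * ‖f ζ‖ₑ with hh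
  set L : Plane → ℝ → ℝ≥0∞ := fun ζ τ => ENNReal.ofReal (kern α (wt ζ) τ * max 1 |τ| ^ β) with hL
  have hwm : ∀ a : ℝ, Measurable fun ζ => ENNReal.ofReal (wt ζ ^ a) := fun a =>
    (measurable_wt.pow_const a).ennreal_ofReal
  have hLm : Measurable (Function.uncurry L) :=
    ((measurable_kern_wt α).mul (by fun_prop)).ennreal_ofReal
  have hS := lintegral_sq_lintegral_shift_le j (L := L) hLm (w := fun ζ => ENNReal.ofReal (wt ζ ^ α))
    (h := h) (hwm α) (fun ζ => by simpa using Real.rpow_pos_of_pos (wt_pos ζ) α) (by simp)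
    ((hwm _).mul hf.enorm) (lintegral_kern_shift_mul_rpow_le j hα hβ0 hβ)
    (lintegral_kern_mul_rpow_le hα hβ0 hβ)
  have hpt : ∀ ζ, ENNReal.ofReal (wt ζ ^ (β / 2)) * phiMajorant j α f ζ ≤
      3 * ∫⁻ τ, L (shift j ζ τ) τ * h (shift j ζ τ) := by
    intro ζ
    rw [phiMajorant, ← lintegral_const_mul' _ _ ENNReal.ofReal_ne_top,
      ← lintegral_const_mul' _ _ ENNReal.ofNat_ne_top]
    refine lintegral_mono fun τ => ?_
    have hM' := wt_pos (shift j ζ τ)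
    have h1 : wt ζ ^ (β / 2) ≤ 3 * (wt (shift j ζ τ) ^ (β / 2) * max 1 |τ| ^ β) := by
      calc wt ζ ^ (β / 2) ≤ (3 * (wt (shift j ζ τ) * max 1 |τ| ^ 2)) ^ (β / 2) :=
            Real.rpow_le_rpow (wt_pos ζ).le (wt_le_shift j ζ τ) (by positivity)
        _ = 3 ^ (β / 2) * (wt (shift j ζ τ) ^ (β / 2) * max 1 |τ| ^ β) := by
            rw [Real.mul_rpow (by norm_num) (by positivity), Real.mul_rpow hM'.le (by positivity),
              ← Real.rpow_natCast (max 1 |τ|) 2, ← Real.rpow_mul (by positivity)]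
            congr 4; push_cast; ring
        _ ≤ 3 * (wt (shift j ζ τ) ^ (β / 2) * max 1 |τ| ^ β) := by
            gcongr
            calc (3 : ℝ) ^ (β / 2) ≤ 3 ^ (1 : ℝ) :=
                  Real.rpow_le_rpow_of_exponent_le (by norm_num) (by linarith)
              _ = 3 := by norm_num
    have hk := kern_nonneg (α := α) hM'.le τ
    simp only [hL, hh]
    calc _ = ENNReal.ofReal (wt ζ ^ (β / 2) * kern α (wt (shift j ζ τ)) τ) * ‖f (shift j ζ τ)‖ₑ := by
          rw [← mul_assoc, ← ENNReal.ofReal_mul (Real.rpow_nonneg (wt_pos ζ).le _)]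
      _ ≤ ENNReal.ofReal (3 * (kern α (wt (shift j ζ τ)) τ * max 1 |τ| ^ β *
            wt (shift j ζ τ) ^ (β / 2))) * ‖f (shift j ζ τ)‖ₑ := by
          refine mul_le_mul_left (ENNReal.ofReal_le_ofReal ?_) _
          calc _ ≤ 3 * (wt (shift j ζ τ) ^ (β / 2) * max 1 |τ| ^ β) *
                kern α (wt (shift j ζ τ)) τ := mul_le_mul_of_nonneg_right h1 hk
            _ = _ := by ring
      _ = _ := by
          rw [ENNReal.ofReal_mul (by norm_num), ENNReal.ofReal_mul (by positivity),
            ENNReal.ofReal_ofNat]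
          ring
  calc _ ≤ ∫⁻ ζ, (3 * ∫⁻ τ, L (shift j ζ τ) τ * h (shift j ζ τ)) ^ 2 := by
        exact lintegral_mono fun ζ => pow_le_pow_left' (hpt ζ) 2
    _ = 9 * ∫⁻ ζ, (∫⁻ τ, L (shift j ζ τ) τ * h (shift j ζ τ)) ^ 2 := by
        simp_rw [mul_pow]
        rw [lintegral_const_mul' _ _ (by norm_num)]
        norm_num
    _ ≤ 9 * (ENNReal.ofReal A * (ENNReal.ofReal B *
          ∫⁻ ζ, ENNReal.ofReal (wt ζ ^ α) ^ 2 * h ζ ^ 2)) := by gcongr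
    _ = ENNReal.ofReal (9 * (A * B)) *
          ∫⁻ ζ, (ENNReal.ofReal (wt ζ ^ (α + β / 2)) * ‖f ζ‖ₑ) ^ 2 := by
        rw [ENNReal.ofReal_mul (by norm_num), ENNReal.ofReal_mul hA0]
        have : ∀ ζ, ENNReal.ofReal (wt ζ ^ α) ^ 2 * h ζ ^ 2 =
            (ENNReal.ofReal (wt ζ ^ (α + β / 2)) * ‖f ζ‖ₑ) ^ 2 := by
          intro ζ
          rw [← mul_pow, hh, ← mul_assoc,
            ← ENNReal.ofReal_mul (Real.rpow_nonneg (wt_pos ζ).le α), ← Real.rpow_add (wt_pos ζ)]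
        simp_rw [this]
        rw [show ENNReal.ofReal 9 = 9 by simp]
        ring
    _ ≤ _ := by
        gcongr
        nlinarith

/-! ### Existence of `Φ` and convergence of the truncations -/

lemma tendsto_setIntegral_abs_ge {h : ℝ → ℂ} (hh : Integrable h) :
    Tendsto (fun ε : ℝ => ∫ τ in {τ : ℝ | ε ≤ |τ|}, h τ) (𝓝[>] (0 : ℝ)) (𝓝 (∫ τ, h τ)) := by
  have hS : ∀ ε : ℝ, MeasurableSet {τ : ℝ | ε ≤ |τ|} := fun ε =>
    measurableSet_le measurable_const (by fun_prop)
  simp_rw [← integral_indicator (hS _)]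
  refine tendsto_integral_filter_of_dominated_convergence (fun τ => ‖h τ‖)
    (Eventually.of_forall fun ε => hh.1.indicator (hS ε))
    (Eventually.of_forall fun ε => Eventually.of_forall fun τ => norm_indicator_le_norm_self _ _)
    hh.norm ?_
  have hae : ∀ᵐ τ : ℝ, τ ≠ 0 := by simp [ae_iff]
  filter_upwards [hae] with τ hτ
  refine tendsto_const_nhds.congr' ?_
  have : ∀ᶠ ε in 𝓝[>] (0 : ℝ), ε < |τ| :=
    (eventually_lt_nhds (abs_pos.2 hτ)).filter_mono nhdsWithin_le_nhds
  filter_upwards [this] with ε hε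
  rw [Set.indicator_of_mem (show τ ∈ {τ : ℝ | ε ≤ |τ|} from hε.le)]

lemma tendsto_norm2_zero_of_dominated {F : ℕ → Plane → ℂ} {G : Plane → ℝ≥0∞}
    (hF : ∀ n, AEStronglyMeasurable (F n) volume) (hG : ∫⁻ x, G x ^ 2 < ∞)
    (hb : ∀ n, ∀ᵐ x, ‖F n x‖ₑ ≤ G x)
    (hlim : ∀ᵐ x, Tendsto (fun n => F n x) atTop (𝓝 0)) :
    Tendsto (fun n => norm2 (F n)) atTop (𝓝 0) := by
  have h1 : Tendsto (fun n => ∫⁻ x, ‖F n x‖ₑ ^ 2) atTop (𝓝 (∫⁻ _ : Plane, 0)) := by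
    refine tendsto_lintegral_of_dominated_convergence' (fun x => G x ^ 2)
      (fun n => (hF n).enorm.pow_const 2) (fun n => ?_) hG.ne ?_
    · filter_upwards [hb n] with x hx
      gcongr
    · filter_upwards [hlim] with x hx
      have h2 := (ENNReal.continuous_pow 2).tendsto _ |>.comp (continuous_enorm.tendsto _ |>.comp hx)
      simpa [Function.comp_def] using h2
  simp only [lintegral_zero, ← norm2_sq] at h1
  have h2 := (ENNReal.continuous_rpow_const (y := 1 / 2)).tendsto _ |>.comp h1
  simp only [Function.comp_def] at h2
  rw [ENNReal.zero_rpow_of_pos (by norm_num)] at h2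
  refine h2.congr fun n => ?_
  rw [← ENNReal.rpow_two, ← ENNReal.rpow_mul]; norm_num

lemma measurable_phase : Measurable phase := by unfold phase; fun_prop

lemma measurable_phiIntegrand (j : Fin 2) (t α : ℝ) {f : Plane → ℂ} (hf : Measurable f) :
    Measurable fun p : Plane × ℝ => phiIntegrand j t α f p.1 p.2 := by
  have h1 := measurable_phase.comp (measurable_shift j)
  have h2 : Measurable fun p : Plane × ℝ => phase p.1 := measurable_phase.comp measurable_fst
  have h3 := hf.comp (measurable_shift j)
  simp only [Function.comp_def] at h1 h3
  have hd := Complex.measurable_ofReal.comp ((h1.sub h2).const_mul t)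
  have hk : Measurable fun p : Plane × ℝ => ((|p.2| ^ (1 + α) : ℝ) : ℂ) := by fun_prop
  exact (((Complex.measurable_exp.comp (hd.const_mul Complex.I)).sub_const 1).div hk).mul h3

lemma lintegral_enorm_phiIntegrand_le (j : Fin 2) (t α : ℝ) (f : Plane → ℂ) (ζ : Plane) :
    ∫⁻ τ, ‖phiIntegrand j t α f ζ τ‖ₑ ≤
      ENNReal.ofReal (20 * (1 + |t|)) * phiMajorant j α f ζ := by
  rw [phiMajorant, ← lintegral_const_mul' _ _ ENNReal.ofReal_ne_top]
  refine lintegral_mono fun τ => ?_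
  have hk := kern_nonneg (α := α) (wt_pos (shift j ζ τ)).le τ
  rw [← ofReal_norm, ← ofReal_norm, ← ENNReal.ofReal_mul hk,
    ← ENNReal.ofReal_mul (by positivity)]
  exact ENNReal.ofReal_le_ofReal (norm_phiIntegrand_le j t α f ζ τ)

lemma integrable_phiIntegrand (j : Fin 2) (t α : ℝ) {f : Plane → ℂ} (hf : Measurable f)
    {ζ : Plane} (hζ : phiMajorant j α f ζ < ∞) : Integrable (phiIntegrand j t α f ζ) :=
  ⟨((measurable_phiIntegrand j t α hf).comp measurable_prodMk_left).aestronglyMeasurable,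
    (lintegral_enorm_phiIntegrand_le j t α f ζ).trans_lt
      (ENNReal.mul_lt_top ENNReal.ofReal_lt_top hζ)⟩

lemma tendsto_phiTrunc (j : Fin 2) (t α : ℝ) {f : Plane → ℂ} (hf : Measurable f)
    {ζ : Plane} (hζ : phiMajorant j α f ζ < ∞) :
    Tendsto (phiTrunc j t α f ζ) (𝓝[>] (0 : ℝ))
      (𝓝 (((dConst α)⁻¹ : ℝ) * ∫ τ, phiIntegrand j t α f ζ τ)) :=
  (tendsto_setIntegral_abs_ge (integrable_phiIntegrand j t α hf hζ)).const_mul _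

lemma Phi_eq_integral (j : Fin 2) (t α : ℝ) {f : Plane → ℂ} (hf : Measurable f)
    {ζ : Plane} (hζ : phiMajorant j α f ζ < ∞) :
    Phi j t α f ζ = ((dConst α)⁻¹ : ℝ) * ∫ τ, phiIntegrand j t α f ζ τ :=
  (tendsto_phiTrunc j t α hf hζ).limUnder_eq

lemma phiDefined_of_ae_lt_top (j : Fin 2) (t α : ℝ) {f : Plane → ℂ} (hf : Measurable f)
    (h : ∀ᵐ ζ, phiMajorant j α f ζ < ∞) : PhiDefined j t α f := by
  filter_upwards [h] with ζ hζ
  refine ⟨fun ε _ => (integrable_phiIntegrand j t α hf hζ).integrableOn, ?_⟩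
  rw [Phi_eq_integral j t α hf hζ]
  exact tendsto_phiTrunc j t α hf hζ

/-- The factor by which `phiMajorant` has to be multiplied to dominate `Φ` and its truncations. -/
noncomputable def phiConst (t α : ℝ) : ℝ := |(dConst α)⁻¹| * (20 * (1 + |t|))

lemma phiConst_nonneg (t α : ℝ) : 0 ≤ phiConst t α := by unfold phiConst; positivity

lemma enorm_dConst_mul_le {j : Fin 2} {t α : ℝ} {f : Plane → ℂ} {ζ : Plane} {z : ℂ}
    (hz : ‖z‖ₑ ≤ ∫⁻ τ, ‖phiIntegrand j t α f ζ τ‖ₑ) :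
    ‖(((dConst α)⁻¹ : ℝ) : ℂ) * z‖ₑ ≤ ENNReal.ofReal (phiConst t α) * phiMajorant j α f ζ := by
  rw [enorm_mul, phiConst, ENNReal.ofReal_mul (abs_nonneg _), mul_assoc, ← ofReal_norm,
    Complex.norm_real, Real.norm_eq_abs]
  gcongr
  exact hz.trans (lintegral_enorm_phiIntegrand_le j t α f ζ)

lemma enorm_phiTrunc_le (j : Fin 2) (t α : ℝ) (f : Plane → ℂ) (ζ : Plane) (ε : ℝ) :
    ‖phiTrunc j t α f ζ ε‖ₑ ≤ ENNReal.ofReal (phiConst t α) * phiMajorant j α f ζ :=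
  enorm_dConst_mul_le ((enorm_integral_le_lintegral_enorm _).trans
    (lintegral_mono' Measure.restrict_le_self le_rfl))

lemma enorm_Phi_le (j : Fin 2) (t α : ℝ) {f : Plane → ℂ} (hf : Measurable f)
    {ζ : Plane} (hζ : phiMajorant j α f ζ < ∞) :
    ‖Phi j t α f ζ‖ₑ ≤ ENNReal.ofReal (phiConst t α) * phiMajorant j α f ζ := by
  rw [Phi_eq_integral j t α hf hζ]
  exact enorm_dConst_mul_le (enorm_integral_le_lintegral_enorm _)

lemma measurable_phiTrunc (j : Fin 2) (t α : ℝ) {f : Plane → ℂ} (hf : Measurable f) (ε : ℝ) :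
    Measurable fun ζ => phiTrunc j t α f ζ ε :=
  ((measurable_phiIntegrand j t α hf).stronglyMeasurable.integral_prod_right'
    (ν := volume.restrict {τ : ℝ | ε ≤ |τ|})).measurable.const_mul _

lemma aestronglyMeasurable_Phi (j : Fin 2) (t α : ℝ) {f : Plane → ℂ} (hf : Measurable f)
    (h : ∀ᵐ ζ, phiMajorant j α f ζ < ∞) : AEStronglyMeasurable (Phi j t α f) volume := by
  have h1 : Measurable fun ζ => ((dConst α)⁻¹ : ℝ) * ∫ τ, phiIntegrand j t α f ζ τ :=
    ((measurable_phiIntegrand j t α hf).stronglyMeasurable.integral_prod_right'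
      (ν := (volume : Measure ℝ))).measurable.const_mul _
  refine h1.aestronglyMeasurable.congr ?_
  filter_upwards [h] with ζ hζ
  exact (Phi_eq_integral j t α hf hζ).symm

lemma ae_phiMajorant_lt_top {j : Fin 2} {α : ℝ} {f : Plane → ℂ} (hf : Measurable f)
    (h : ∫⁻ ζ, phiMajorant j α f ζ ^ 2 < ∞) : ∀ᵐ ζ, phiMajorant j α f ζ < ∞ := by
  filter_upwards [ae_lt_top ((measurable_phiMajorant j α hf).pow_const 2) h.ne] with ζ hζ
  by_contra hc
  rw [not_lt, top_le_iff] at hc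
  simp [hc] at hζ

lemma tendsto_norm2_phiTrunc_sub_Phi (j : Fin 2) (t α : ℝ) {f : Plane → ℂ} (hf : Measurable f)
    (h : ∫⁻ ζ, phiMajorant j α f ζ ^ 2 < ∞) {ε : ℕ → ℝ} (hε : Tendsto ε atTop (𝓝[>] 0)) :
    Tendsto (fun n => norm2 fun ζ => phiTrunc j t α f ζ (ε n) - Phi j t α f ζ) atTop (𝓝 0) := by
  have hae := ae_phiMajorant_lt_top hf h
  refine tendsto_norm2_zero_of_dominated
    (G := fun ζ => 2 * ENNReal.ofReal (phiConst t α) * phiMajorant j α f ζ)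
    (fun n => (measurable_phiTrunc j t α hf (ε n)).aestronglyMeasurable.sub
      (aestronglyMeasurable_Phi j t α hf hae)) ?_ (fun n => ?_) ?_
  · simp_rw [mul_pow]
    rw [lintegral_const_mul' _ _ (by finiteness)]
    exact ENNReal.mul_lt_top (by finiteness) h
  · filter_upwards [hae] with ζ hζ
    refine (enorm_sub_le).trans ?_
    rw [mul_assoc, two_mul]
    exact add_le_add (enorm_phiTrunc_le j t α f ζ _) (enorm_Phi_le j t α hf hζ)
  · filter_upwards [hae] with ζ hζ
    have := (tendsto_phiTrunc j t α hf hζ).comp hε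
    rw [← Phi_eq_integral j t α hf hζ] at this
    simpa using this.sub_const (Phi j t α f ζ)

/-- Multiplication by the real weight `(1 + |ζ|²)^a`. -/
noncomputable def wtMul (a : ℝ) (f : Plane → ℂ) (ζ : Plane) : ℂ := ((wt ζ ^ a : ℝ) : ℂ) * f ζ

lemma enorm_wtMul (a : ℝ) (f : Plane → ℂ) (ζ : Plane) :
    ‖wtMul a f ζ‖ₑ = ENNReal.ofReal (wt ζ ^ a) * ‖f ζ‖ₑ := by
  rw [wtMul, enorm_mul, ← ofReal_norm, Complex.norm_real,
    Real.norm_of_nonneg (Real.rpow_nonneg (wt_pos ζ).le a)]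

lemma lintegral_phiMajorant_sq_lt_top {α : ℝ} (h0 : 0 < α) (h1 : α < 1) (j : Fin 2)
    {f : Plane → ℂ} (hf : Measurable f) (h : MemLp (wtMul α f) 2 volume) :
    ∫⁻ ζ, phiMajorant j α f ζ ^ 2 < ∞ := by
  obtain ⟨C, _, hC⟩ := exists_lintegral_phiMajorant_le h1 le_rfl h0
  have h2 := hC j f hf
  simp only [zero_div, Real.rpow_zero, ENNReal.ofReal_one, one_mul, add_zero,
    ← enorm_wtMul, ← norm2_sq] at h2
  exact h2.trans_lt (ENNReal.mul_lt_top ENNReal.ofReal_lt_top (ENNReal.pow_lt_top h.2))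

/-- The weighted `L²` estimate for `Φ`, with linear growth in `t`. -/
lemma exists_norm2_wtMul_Phi_le {α β : ℝ} (hα : α < 1) (hβ0 : 0 ≤ β) (hβ : β < α) :
    ∃ c : ℝ, 0 < c ∧ ∀ (j : Fin 2) (t : ℝ) (f : Plane → ℂ), Measurable f →
      MemLp (wtMul (α + β / 2) f) 2 volume →
        MemLp (wtMul (β / 2) (Phi j t α f)) 2 volume ∧
        norm2 (wtMul (β / 2) (Phi j t α f)) ≤
          ENNReal.ofReal (c * (1 + |t|)) * norm2 (wtMul (α + β / 2) f) := by
  have hα0 : 0 < α := hβ0.trans_lt hβ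
  obtain ⟨C, hC0, hC⟩ := exists_lintegral_phiMajorant_le hα hβ0 hβ
  refine ⟨|(dConst α)⁻¹| * 20 * C, ?_, fun j t f hf h => ?_⟩
  · have := abs_pos.2 (inv_ne_zero (dConst_neg hα0 hα).ne)
    positivity
  have hC' := hC j f hf
  simp only [← enorm_wtMul, ← norm2_sq] at hC'
  have hfin : ∫⁻ ζ, (ENNReal.ofReal (wt ζ ^ (β / 2)) * phiMajorant j α f ζ) ^ 2 < ∞ :=
    hC'.trans_lt (ENNReal.mul_lt_top ENNReal.ofReal_lt_top (ENNReal.pow_lt_top h.2))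
  have hae : ∀ᵐ ζ, phiMajorant j α f ζ < ∞ := by
    refine ae_phiMajorant_lt_top hf (lt_of_le_of_lt (lintegral_mono fun ζ => ?_) hfin)
    refine pow_le_pow_left' (le_mul_of_one_le_left' ?_) 2
    rw [ENNReal.one_le_ofReal]
    exact Real.one_le_rpow (one_le_wt ζ) (by positivity)
  have hb : ∀ᵐ ζ, ‖wtMul (β / 2) (Phi j t α f) ζ‖ₑ ≤ ENNReal.ofReal (phiConst t α) *
      (ENNReal.ofReal (wt ζ ^ (β / 2)) * phiMajorant j α f ζ) := by
    filter_upwards [hae] with ζ hζ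
    rw [enorm_wtMul, mul_left_comm]
    gcongr
    exact enorm_Phi_le j t α hf hζ
  have hsq : ∫⁻ ζ, (ENNReal.ofReal (phiConst t α) *
      (ENNReal.ofReal (wt ζ ^ (β / 2)) * phiMajorant j α f ζ)) ^ 2 ≤
      (ENNReal.ofReal (phiConst t α * C) * norm2 (wtMul (α + β / 2) f)) ^ 2 := by
    simp_rw [mul_pow (ENNReal.ofReal (phiConst t α))]
    rw [lintegral_const_mul' _ _ (by finiteness), ENNReal.ofReal_mul (phiConst_nonneg t α),
      mul_pow, mul_pow, mul_assoc, ← ENNReal.ofReal_pow hC0.le]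
    gcongr
  have hmeas : AEStronglyMeasurable (wtMul (β / 2) (Phi j t α f)) volume := by
    refine AEStronglyMeasurable.mul ?_ (aestronglyMeasurable_Phi j t α hf hae)
    exact (Complex.measurable_ofReal.comp (measurable_wt.pow_const _)).aestronglyMeasurable
  refine ⟨memLp_two_of_enorm_le hmeas (hsq.trans_lt ?_) hb, ?_⟩
  · exact ENNReal.pow_lt_top (ENNReal.mul_lt_top ENNReal.ofReal_lt_top h.2)
  · rw [← ENNReal.pow_le_pow_left_iff two_ne_zero, norm2_sq]
    refine (lintegral_mono_ae (hb.mono fun ζ hζ => pow_le_pow_left' hζ 2)).trans (hsq.trans ?_)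
    rw [phiConst]
    refine le_of_eq ?_
    congr 3
    ring

/-! ### The group `W` and the truncated Stein derivative -/

/-- The symbol `e^{itφ}` of `W t`. -/
noncomputable def grp (t : ℝ) (ζ : Plane) : ℂ :=
  Complex.exp (Complex.I * ((t * phase ζ : ℝ) : ℂ))

lemma norm_grp (t : ℝ) (ζ : Plane) : ‖grp t ζ‖ = 1 := Complex.norm_exp_I_mul_ofReal _

lemma measurable_grp (t : ℝ) : Measurable (grp t) := by
  have := measurable_phase
  unfold grp
  fun_prop

lemma memLp_grp_mul {t : ℝ} {f : Plane → ℂ} (hf : MemLp f 2 volume) :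
    MemLp (fun ζ => grp t ζ * f ζ) 2 volume :=
  hf.of_le ((measurable_grp t).aestronglyMeasurable.mul hf.1)
    (Eventually.of_forall fun ζ => by rw [norm_mul, norm_grp, one_mul])

lemma norm2_grp_mul (t : ℝ) (f : Plane → ℂ) : norm2 (fun ζ => grp t ζ * f ζ) = norm2 f :=
  eLpNorm_congr_norm_ae (Eventually.of_forall fun ζ => by rw [norm_mul, norm_grp, one_mul])

lemma W_eq (t : ℝ) (v : Plane → ℂ) : W t v = fourierInv fun ζ => grp t ζ * fourier v ζ := rfl

lemma W_congr {t : ℝ} {v w : Plane → ℂ} (h : v =ᵐ[volume] w) : W t v = W t w := by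
  rw [W_eq, W_eq, fourier_congr h]

lemma memLp_W (t : ℝ) (v : Plane → ℂ) : MemLp (W t v) 2 volume := memLp_fourierInv _

lemma fourier_W (t : ℝ) (v : Plane → ℂ) :
    fourier (W t v) =ᵐ[volume] fun ζ => grp t ζ * fourier v ζ :=
  fourier_fourierInv (memLp_grp_mul (memLp_fourier v))

lemma norm2_W {t : ℝ} {v : Plane → ℂ} (hv : MemLp v 2 volume) : norm2 (W t v) = norm2 v := by
  rw [W_eq, norm2_fourierInv (memLp_grp_mul (memLp_fourier v)), norm2_grp_mul, norm2_fourier hv]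

lemma W_fourierInv (t : ℝ) {g : Plane → ℂ} (hg : MemLp g 2 volume) :
    W t (fourierInv g) = fourierInv fun ζ => grp t ζ * g ζ := by
  rw [W_eq]
  refine fourierInv_congr ?_
  filter_upwards [fourier_fourierInv hg] with ζ hζ
  rw [hζ]

lemma W_add {t : ℝ} {v w : Plane → ℂ} (hv : MemLp v 2 volume) (hw : MemLp w 2 volume) :
    W t (v + w) =ᵐ[volume] W t v + W t w := by
  refine EventuallyEq.trans ?_ (fourierInv_add (memLp_grp_mul (memLp_fourier v))
    (memLp_grp_mul (memLp_fourier w)))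
  refine (fourierInv_congr ?_).eventuallyEq
  filter_upwards [fourier_add hv hw] with ζ hζ
  rw [hζ, Pi.add_apply, Pi.add_apply, mul_add]

lemma W_sub {t : ℝ} {v w : Plane → ℂ} (hv : MemLp v 2 volume) (hw : MemLp w 2 volume) :
    W t (v - w) =ᵐ[volume] W t v - W t w := by
  have h := W_add (t := t) (hv.sub hw) hw
  rw [sub_add_cancel] at h
  filter_upwards [h] with x hx
  simp only [Pi.add_apply] at hx
  simp [hx]

lemma fourierInv_const_mul (c : ℂ) {f : Plane → ℂ} (hf : MemLp f 2 volume) :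
    fourierInv (fun x => c * f x) =ᵐ[volume] fun x => c * fourierInv f x := by
  have hcf : MemLp (fun x => c * f x) 2 volume := hf.const_mul c
  have h0 : hcf.toLp _ = c • hf.toLp _ := rfl
  rw [fourierInv_of_memLp hf, fourierInv_of_memLp hcf, h0, FourierTransform.fourierInv_smul]
  have := (Measure.quasiMeasurePreserving_smul (volume : Measure Plane)
    two_pi_inv_pos.ne').ae_eq_comp (Lp.coeFn_smul c (𝓕⁻ (hf.toLp f) : Lp ℂ 2 (volume : Measure Plane)))
  filter_upwards [this] with x hx
  simp only [Function.comp_apply, Pi.smul_apply, smul_eq_mul] at hx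
  rw [hx]
  ring

lemma W_const_mul (t : ℝ) (c : ℂ) {v : Plane → ℂ} (hv : MemLp v 2 volume) :
    W t (fun x => c * v x) =ᵐ[volume] fun x => c * W t v x := by
  have h1 : fourier (fun x => c * v x) =ᵐ[volume] fun ζ => c * fourier v ζ := by
    have h2 : fourierInv (fun ζ => c * fourier v ζ) =ᵐ[volume] fun x => c * v x := by
      filter_upwards [fourierInv_const_mul c (memLp_fourier v), fourierInv_fourier hv] with x h1 h2
      rw [h1, h2]
    rw [← fourier_congr h2]
    exact fourier_fourierInv ((memLp_fourier v).const_mul c)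
  refine EventuallyEq.trans ?_ (fourierInv_const_mul c (memLp_grp_mul (memLp_fourier v)))
  refine (fourierInv_congr ?_).eventuallyEq
  filter_upwards [h1] with ζ hζ
  rw [hζ]; ring

lemma measurableSet_abs_ge (ε : ℝ) : MeasurableSet {τ : ℝ | ε ≤ |τ|} :=
  measurableSet_le measurable_const (by fun_prop)

/-- The truncated and normalized Stein kernel `d_α⁻¹ 1_{|τ| ≥ ε} |τ|^{-1-α}`. -/
noncomputable def steinKernel (α ε : ℝ) : ℝ → ℂ :=
  {τ : ℝ | ε ≤ |τ|}.indicator fun τ => (((dConst α)⁻¹ / |τ| ^ (1 + α) : ℝ) : ℂ)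

lemma measurable_steinKernel (α ε : ℝ) : Measurable (steinKernel α ε) :=
  Measurable.indicator (by fun_prop) (measurableSet_abs_ge ε)

lemma integrable_steinKernel {α ε : ℝ} (h0 : 0 < α) (h1 : α < 1) (hε : 0 < ε) :
    Integrable (steinKernel α ε) := by
  refine ((integrable_kern h0 h1 (inv_pos.2 hε)).const_mul |(dConst α)⁻¹|).mono'
    (measurable_steinKernel α ε).aestronglyMeasurable (Eventually.of_forall fun τ => ?_)
  by_cases hτ : ε ≤ |τ|
  · rw [steinKernel, Set.indicator_of_mem (by exact hτ), Complex.norm_real, norm_div,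
      Real.norm_of_nonneg (Real.rpow_nonneg (abs_nonneg τ) _), Real.norm_eq_abs, kern, min_eq_left,
      mul_one_div]
    rw [← div_eq_mul_inv]
    exact (one_le_div hε).2 hτ
  · rw [steinKernel, Set.indicator_of_notMem (by exact hτ), norm_zero]
    exact mul_nonneg (abs_nonneg _) (kern_nonneg (inv_pos.2 hε).le τ)

/-- The symbol of the truncated Stein derivative. -/
noncomputable def steinSymbol (α ε x : ℝ) : ℂ :=
  (((dConst α)⁻¹ : ℝ) : ℂ) * ∫ τ in {τ : ℝ | ε ≤ |τ|}, expKernel α x τ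

lemma measurable_steinSymbol (α ε : ℝ) : Measurable (steinSymbol α ε) :=
  ((measurable_expKernel α).stronglyMeasurable.integral_prod_right'
    (ν := volume.restrict {τ : ℝ | ε ≤ |τ|})).measurable.const_mul _

lemma steinSymbol_eq {α ε : ℝ} (h0 : 0 < α) (h1 : α < 1) (hε : 0 < ε) (x : ℝ) :
    steinSymbol α ε x =
      (∫ τ, steinKernel α ε τ * Complex.exp (Complex.I * ((-(τ * x) : ℝ) : ℂ))) -
        ∫ τ, steinKernel α ε τ := by
  have hk := integrable_steinKernel h0 h1 hε
  have hke : Integrable fun τ =>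
      steinKernel α ε τ * Complex.exp (Complex.I * ((-(τ * x) : ℝ) : ℂ)) :=
    hk.mul_bdd (c := 1) (by fun_prop)
      (Eventually.of_forall fun τ => (Complex.norm_exp_I_mul_ofReal _).le)
  rw [← integral_sub hke hk, steinSymbol, ← integral_const_mul,
    ← integral_indicator (measurableSet_abs_ge ε)]
  congr 1; ext τ
  by_cases hτ : τ ∈ {τ : ℝ | ε ≤ |τ|}
  · rw [Set.indicator_of_mem hτ, steinKernel, Set.indicator_of_mem hτ, expKernel]
    push_cast; ring
  · rw [Set.indicator_of_notMem hτ, steinKernel, Set.indicator_of_notMem hτ]; ring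

lemma tendsto_steinSymbol {α : ℝ} (h0 : 0 < α) (h1 : α < 1) (x : ℝ) :
    Tendsto (fun ε => steinSymbol α ε x) (𝓝[>] 0) (𝓝 ((|x| ^ α : ℝ) : ℂ)) := by
  have h := (tendsto_setIntegral_abs_ge (integrable_expKernel h0 h1 x)).const_mul
    (((dConst α)⁻¹ : ℝ) : ℂ)
  rwa [integral_expKernel h0 h1, ← Complex.ofReal_mul,
    inv_mul_cancel_left₀ (dConst_neg h0 h1).ne] at h

lemma norm_steinSymbol_le {α : ℝ} (h0 : 0 < α) (h1 : α < 1) (ε x : ℝ) :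
    ‖steinSymbol α ε x‖ ≤ |(dConst α)⁻¹| * 2 * (∫ τ, kern α 1 τ) * |x| ^ α := by
  rcases eq_or_ne x 0 with rfl | hx
  · simp [steinSymbol, expKernel_zero, Real.zero_rpow h0.ne']
  · have hx' := abs_pos.2 hx
    have hi := (integrable_kern h0 h1 hx').const_mul 2
    rw [steinSymbol, norm_mul, Complex.norm_real, Real.norm_eq_abs, mul_assoc, mul_assoc]
    gcongr
    calc _ ≤ ∫ τ in {τ : ℝ | ε ≤ |τ|}, 2 * kern α |x| τ :=
          norm_integral_le_of_norm_le hi.integrableOn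
            (Eventually.of_forall fun τ => norm_expKernel_le α x τ)
      _ ≤ ∫ τ, 2 * kern α |x| τ := setIntegral_le_integral hi
          (Eventually.of_forall fun τ => mul_nonneg zero_le_two (kern_nonneg hx'.le τ))
      _ = _ := by rw [integral_const_mul, integral_kern hx']; ring

/-- Conjugation of the truncated Stein derivative by `e^{itφ}` produces the truncation of `Φ`. -/
lemma grp_mul_phiTrunc (j : Fin 2) (t : ℝ) {α ε : ℝ} (h0 : 0 < α) (h1 : α < 1) (hε : 0 < ε)
    {f : Plane → ℂ} (hfm : Measurable f) (hf : MemLp f 2 volume) :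
    (fun ζ => grp t ζ * phiTrunc j t α f ζ ε) =ᵐ[volume]
      (lineConv j (steinKernel α ε) fun ζ => grp t ζ * f ζ) -
        fun ζ => grp t ζ * lineConv j (steinKernel α ε) f ζ := by
  have hk := integrable_steinKernel h0 h1 hε
  have hkm := measurable_steinKernel α ε
  filter_upwards [ae_integrable_lineConv j hk hkm hfm hf,
    ae_integrable_lineConv j hk hkm ((measurable_grp t).mul hfm) (memLp_grp_mul (t := t) hf)]
    with ζ hζ1 hζ2
  simp only [Pi.sub_apply]
  simp only [Pi.mul_apply] at hζ2
  rw [lineConv, lineConv, ← integral_const_mul, ← integral_sub hζ2 (hζ1.const_mul _), phiTrunc,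
    ← integral_const_mul, ← integral_const_mul, ← integral_indicator (measurableSet_abs_ge ε)]
  congr 1; ext τ
  by_cases hτ : τ ∈ {τ : ℝ | ε ≤ |τ|}
  · rw [Set.indicator_of_mem hτ, steinKernel, Set.indicator_of_mem hτ, phiIntegrand]
    have : grp t (shift j ζ τ) = grp t ζ *
        Complex.exp (Complex.I * ((t * (phase (shift j ζ τ) - phase ζ) : ℝ) : ℂ)) := by
      rw [grp, grp, ← Complex.exp_add]
      congr 1; push_cast; ring
    rw [this]
    push_cast; ring
  · rw [Set.indicator_of_notMem hτ, steinKernel, Set.indicator_of_notMem hτ]; ring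

lemma memLp_phiTrunc (j : Fin 2) (t : ℝ) {α ε : ℝ} (h0 : 0 < α) (h1 : α < 1) (hε : 0 < ε)
    {f : Plane → ℂ} (hfm : Measurable f) (hf : MemLp f 2 volume) :
    MemLp (fun ζ => phiTrunc j t α f ζ ε) 2 volume := by
  have hk := integrable_steinKernel h0 h1 hε
  have hkm := measurable_steinKernel α ε
  have h : MemLp (fun ζ => grp t ζ * phiTrunc j t α f ζ ε) 2 volume :=
    (memLp_congr_ae (grp_mul_phiTrunc j t h0 h1 hε hfm hf)).2
    ((memLp_lineConv j hk hkm ((measurable_grp t).mul hfm) (memLp_grp_mul hf)).sub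
      (memLp_grp_mul (memLp_lineConv j hk hkm hfm hf)))
  exact h.of_le (measurable_phiTrunc j t α hfm ε).aestronglyMeasurable
    (Eventually.of_forall fun ζ => by rw [norm_mul, norm_grp, one_mul])

/-- The formula for `|x_j|^α W(t) u`, with the symbol `|x_j|^α` and `Φ` truncated. -/
lemma steinSymbol_mul_W (j : Fin 2) (t : ℝ) {α ε : ℝ} (h0 : 0 < α) (h1 : α < 1) (hε : 0 < ε)
    {u : Plane → ℂ} (hu : MemLp u 2 volume)
    (hmu : MemLp (fun x => steinSymbol α ε (x j) * u x) 2 volume) :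
    (fun x => steinSymbol α ε (x j) * W t u x) =ᵐ[volume]
      W t (fun x => steinSymbol α ε (x j) * u x) +
        W t (fourierInv fun ζ => phiTrunc j t α (fourier u) ζ ε) := by
  have hk := integrable_steinKernel h0 h1 hε
  have hkm := measurable_steinKernel α ε
  have hfm := measurable_fourier u
  have hf := memLp_fourier u
  set f := fourier u with hf_def
  set c : ℂ := ∫ τ, steinKernel α ε τ with hc
  have hC1 := memLp_lineConv j hk hkm hfm hf
  have hC2 := memLp_lineConv j hk hkm ((measurable_grp t).mul hfm) (memLp_grp_mul (t := t) hf)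
  have e1 := fourierInv_lineConv j hk hkm ((measurable_grp t).mul hfm) (memLp_grp_mul (t := t) hf)
  have e2 := fourierInv_lineConv j hk hkm hfm hf
  have e3 : fourierInv (lineConv j (steinKernel α ε) f) =ᵐ[volume]
      (fun x => steinSymbol α ε (x j) * u x) + fun x => c * u x := by
    filter_upwards [e2, fourierInv_fourier hu] with x hx1 hx2
    simp only [Pi.add_apply]
    rw [hx1, hx2, steinSymbol_eq h0 h1 hε]; ring
  have e4 : W t (fourierInv (lineConv j (steinKernel α ε) f)) =ᵐ[volume]
      W t (fun x => steinSymbol α ε (x j) * u x) + fun x => c * W t u x := by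
    rw [W_congr e3]
    exact (W_add hmu (hu.const_mul c)).trans (EventuallyEq.rfl.add (W_const_mul t c hu))
  have e5 : W t (fourierInv fun ζ => phiTrunc j t α f ζ ε) =ᵐ[volume]
      (fourierInv (lineConv j (steinKernel α ε) fun ζ => grp t ζ * f ζ)) -
        W t (fourierInv (lineConv j (steinKernel α ε) f)) := by
    rw [W_fourierInv t (memLp_phiTrunc j t h0 h1 hε hfm hf), W_fourierInv t hC1,
      fourierInv_congr (grp_mul_phiTrunc j t h0 h1 hε hfm hf)]
    exact fourierInv_sub hC2 (memLp_grp_mul hC1)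
  filter_upwards [e1, e4, e5] with x h1' h4 h5
  simp only [Pi.add_apply, Pi.sub_apply] at h4 h5 ⊢
  rw [h5, h4]
  have h1'' : fourierInv (lineConv j (steinKernel α ε) fun ζ => grp t ζ * f ζ) x =
      (steinSymbol α ε (x j) + c) * W t u x := by
    refine h1'.trans ?_
    rw [steinSymbol_eq h0 h1 hε, W_eq]
    simp only [hc, sub_add_cancel]
    rfl
  rw [h1'']
  ring

/-- The formula for `|x_j|^α W(t) u`: the truncated formula passes to the limit in `L²` on the
right-hand side and pointwise on the left-hand side. -/
lemma weight_W (j : Fin 2) (t : ℝ) {α : ℝ} (h0 : 0 < α) (h1 : α < 1)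
    {u : Plane → ℂ} (hu : MemLp u 2 volume) (hwu : MemLp (weight j α u) 2 volume)
    (hΦ : ∫⁻ ζ, phiMajorant j α (fourier u) ζ ^ 2 < ∞)
    (hΦ2 : MemLp (Phi j t α (fourier u)) 2 volume) :
    weight j α (W t u) =ᵐ[volume]
      W t (weight j α u) + W t (fourierInv (Phi j t α (fourier u))) := by
  have hfm := measurable_fourier u
  have hf := memLp_fourier u
  set ε : ℕ → ℝ := fun n => 1 / ((n : ℝ) + 1) with hε_def
  have hε0 : ∀ n, 0 < ε n := fun n => by positivity
  have hε : Tendsto ε atTop (𝓝[>] 0) :=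
    tendsto_nhdsWithin_iff.2 ⟨tendsto_one_div_add_atTop_nhds_zero_nat, Eventually.of_forall hε0⟩
  set c := |(dConst α)⁻¹| * 2 * ∫ τ, kern α 1 τ with hc
  have hc0 : 0 ≤ c := by
    have : 0 ≤ ∫ τ, kern α 1 τ := integral_nonneg (kern_nonneg zero_le_one)
    positivity
  have hsm : ∀ n, Measurable fun x : Plane => steinSymbol α (ε n) (x j) := fun n =>
    (measurable_steinSymbol α (ε n)).comp (by fun_prop)
  have hbd : ∀ n x, ‖steinSymbol α (ε n) (x j) * u x‖ ≤ c * ‖weight j α u x‖ := by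
    intro n x
    rw [weight, norm_mul, norm_mul, Complex.norm_real,
      Real.norm_of_nonneg (Real.rpow_nonneg (abs_nonneg _) _), ← mul_assoc]
    gcongr
    exact norm_steinSymbol_le h0 h1 _ _
  have hmu : ∀ n, MemLp (fun x => steinSymbol α (ε n) (x j) * u x) 2 volume := fun n =>
    hwu.of_le_mul ((hsm n).aestronglyMeasurable.mul hu.1) (Eventually.of_forall (hbd n))
  have hlim1 : Tendsto (fun n => norm2 fun x => steinSymbol α (ε n) (x j) * u x - weight j α u x)
      atTop (𝓝 0) := by
    refine tendsto_norm2_zero_of_dominated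
      (G := fun x => ENNReal.ofReal (c + 1) * ‖weight j α u x‖ₑ)
      (fun n => (hmu n).1.sub hwu.1) ?_ (fun n => Eventually.of_forall fun x => ?_)
      (Eventually.of_forall fun x => ?_)
    · simp_rw [mul_pow]
      rw [lintegral_const_mul' _ _ (by finiteness), ← norm2_sq]
      exact ENNReal.mul_lt_top (by finiteness) (ENNReal.pow_lt_top hwu.2)
    · rw [← ofReal_norm, ← ofReal_norm, ← ENNReal.ofReal_mul (by positivity)]
      apply ENNReal.ofReal_le_ofReal
      refine (norm_sub_le _ _).trans ?_
      linarith [hbd n x]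
    · have := (((tendsto_steinSymbol h0 h1 (x j)).comp hε).mul_const (u x)).sub_const
        (weight j α u x)
      simpa [weight] using this
  have hlim2 := tendsto_norm2_phiTrunc_sub_Phi j t α hfm hΦ hε
  have hT : ∀ n, MemLp (fun ζ => phiTrunc j t α (fourier u) ζ (ε n)) 2 volume := fun n =>
    memLp_phiTrunc j t h0 h1 (hε0 n) hfm hf
  set R := W t (weight j α u) + W t (fourierInv (Phi j t α (fourier u))) with hR
  have hRm : MemLp R 2 volume := (memLp_W _ _).add (memLp_W _ _)
  set F : ℕ → Plane → ℂ := fun n x => steinSymbol α (ε n) (x j) * W t u x with hF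
  have hFm : ∀ n, AEStronglyMeasurable (F n) volume := fun n =>
    (hsm n).aestronglyMeasurable.mul (memLp_W t u).1
  have hFR : ∀ n, norm2 (F n - R) ≤
      norm2 (fun x => steinSymbol α (ε n) (x j) * u x - weight j α u x) +
      norm2 (fun ζ => phiTrunc j t α (fourier u) ζ (ε n) - Phi j t α (fourier u) ζ) := by
    intro n
    have a1 := (hmu n).sub hwu
    have a2 := (memLp_fourierInv fun ζ => phiTrunc j t α (fourier u) ζ (ε n)).sub
      (memLp_fourierInv (Phi j t α (fourier u)))
    have e : F n - R =ᵐ[volume] W t ((fun x => steinSymbol α (ε n) (x j) * u x) - weight j α u) +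
        W t ((fourierInv fun ζ => phiTrunc j t α (fourier u) ζ (ε n)) -
          fourierInv (Phi j t α (fourier u))) := by
      filter_upwards [steinSymbol_mul_W j t h0 h1 (hε0 n) hu (hmu n), W_sub (t := t) (hmu n) hwu,
        W_sub (t := t) (memLp_fourierInv fun ζ => phiTrunc j t α (fourier u) ζ (ε n))
          (memLp_fourierInv (Phi j t α (fourier u)))] with x b1 b2 b3
      simp only [hF, hR, Pi.sub_apply, Pi.add_apply] at b1 b2 b3 ⊢
      rw [b1, b2, b3]; ring
    rw [norm2, eLpNorm_congr_ae e]
    refine (eLpNorm_add_le (memLp_W _ _).1 (memLp_W _ _).1 one_le_two).trans ?_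
    refine add_le_add (norm2_W a1).le ?_
    refine (norm2_W a2).le.trans (le_of_eq ?_)
    rw [norm2, ← eLpNorm_congr_ae (fourierInv_sub (hT n) hΦ2)]
    exact norm2_fourierInv ((hT n).sub hΦ2)
  have hlim : Tendsto (fun n => eLpNorm (F n - R) 2 volume) atTop (𝓝 0) := by
    have := hlim1.add hlim2
    rw [add_zero] at this
    exact tendsto_of_tendsto_of_tendsto_of_le_of_le tendsto_const_nhds this (fun _ => zero_le) hFR
  obtain ⟨ns, hns, hae⟩ := (tendstoInMeasure_of_tendsto_eLpNorm two_ne_zero hFm hRm.1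
    hlim).exists_seq_tendsto_ae
  filter_upwards [hae] with x hx
  have h2 := (((tendsto_steinSymbol h0 h1 (x j)).comp hε).comp hns.tendsto_atTop).mul_const (W t u x)
  exact tendsto_nhds_unique h2 hx

/-! ### Sobolev regularity and weights on the frequency side -/

/-- The Bessel-potential definition of `H^s`, read as a weighted `L²` condition on the transform. -/
lemma memLp_bessel_mul_fourier_Lp {s : ℝ} (hs : 0 ≤ s) {u : Lp ℂ 2 (volume : Measure Plane)}
    (h : TemperedDistribution.MemSobolev s 2 (u : 𝓢'(Plane, ℂ))) :
    MemLp (wtMul (s / 2) (𝓕 u : Lp ℂ 2 (volume : Measure Plane))) 2 volume := by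
  obtain ⟨v, hv⟩ := TemperedDistribution.memSobolev_iff_exists_smulLeftCLM_fourier.1 h
  rw [Lp.fourier_toTemperedDistribution_eq] at hv
  have hg : (fun x : Plane => (((1 + ‖x‖ ^ 2) ^ (-s / 2) : ℝ) : ℂ)).HasTemperateGrowth := by fun_prop
  have hg2 : MemLp (fun x : Plane => (((1 + ‖x‖ ^ 2) ^ (-s / 2) : ℝ) : ℂ)) ∞ volume := by
    refine memLp_top_of_bound hg.1.continuous.aestronglyMeasurable 1 (Eventually.of_forall fun x => ?_)
    rw [Complex.norm_real, Real.norm_of_nonneg (by positivity)]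
    exact Real.rpow_le_one_of_one_le_of_nonpos (one_le_wt x) (by linarith)
  -- dividing by the Bessel symbol shows that `𝓕 u` agrees with the class of `(1 + |x|²)^{-s/2} v`
  have h1 : ((hg2.toLp _ • v : Lp ℂ 2 (volume : Measure Plane)) : 𝓢'(Plane, ℂ)) =
      (𝓕 u : Lp ℂ 2 (volume : Measure Plane)) := by
    rw [Lp.toTemperedDistribution_smul_eq hg hg2, ← hv,
      TemperedDistribution.smulLeftCLM_smulLeftCLM_apply (by fun_prop) hg]
    convert! TemperedDistribution.smulLeftCLM_const 1
      ((𝓕 u : Lp ℂ 2 (volume : Measure Plane)) : 𝓢'(Plane, ℂ)) using 1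
    · congr
      ext x
      rw [Pi.mul_apply, ← Complex.ofReal_mul, ← Real.rpow_add (by positivity)]
      ring_nf
      simp
    · simp
  have h2 : (hg2.toLp _ • v : Lp ℂ 2 (volume : Measure Plane)) = 𝓕 u :=
    LinearMap.ker_eq_bot.mp (Lp.ker_toTemperedDistributionCLM_eq_bot (F := ℂ)
      (μ := (volume : Measure Plane)) (p := 2)) h1
  refine (memLp_congr_ae ?_).1 (Lp.memLp v)
  rw [← h2]
  filter_upwards [Lp.coeFn_lpSMul (r := 2) (hg2.toLp _) v, hg2.coeFn_toLp] with x hx1 hx2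
  rw [wtMul, hx1, Pi.smul_apply', hx2, smul_eq_mul, ← mul_assoc, ← Complex.ofReal_mul, wt,
    ← Real.rpow_add (by positivity)]
  ring_nf
  simp

lemma abs_apply_le_norm (j : Fin 2) (ξ : Plane) : |ξ j| ≤ ‖ξ‖ := by
  simpa using PiLp.norm_apply_le ξ j

lemma memLp_dirSymbol_mul_fourier {s : ℝ} (hs : 0 ≤ s) {u : Plane → ℂ} (hu : MemH s u)
    (j : Fin 2) : MemLp (fun ξ => dirSymbol j s ξ * fourier u ξ) 2 volume := by
  obtain ⟨hu2, hS⟩ := hu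
  have h1 := memLp_comp_smul two_pi_inv_pos.ne' (memLp_bessel_mul_fourier_Lp hs hS)
  refine h1.of_le_mul (c := ((2 * Real.pi)⁻¹) * (2 * Real.pi) ^ s) ?_
    (Eventually.of_forall fun ξ => ?_)
  · have : Measurable (dirSymbol j s) := by unfold dirSymbol; fun_prop
    exact this.aestronglyMeasurable.mul (memLp_fourier u).1
  · rw [fourier_of_memLp hu2, dirSymbol, wtMul]
    simp only [norm_mul, Complex.norm_real]
    rw [Real.norm_of_nonneg (by positivity), Real.norm_of_nonneg two_pi_inv_pos.le,
      Real.norm_of_nonneg (Real.rpow_nonneg (wt_pos _).le _)]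
    have h2 : |ξ j| ^ s ≤ (2 * Real.pi) ^ s * wt ((2 * Real.pi)⁻¹ • ξ) ^ (s / 2) := by
      have h3 : |ξ j| ≤ 2 * Real.pi * wt ((2 * Real.pi)⁻¹ • ξ) ^ (1 / 2 : ℝ) := by
        have h4 : ‖(2 * Real.pi)⁻¹ • ξ‖ ≤ wt ((2 * Real.pi)⁻¹ • ξ) ^ (1 / 2 : ℝ) := by
          rw [← Real.sqrt_eq_rpow]
          apply Real.le_sqrt_of_sq_le
          unfold wt; linarith
        rw [norm_smul, Real.norm_of_nonneg two_pi_inv_pos.le, inv_mul_le_iff₀ (by positivity)] at h4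
        exact (abs_apply_le_norm j ξ).trans h4
      calc |ξ j| ^ s ≤ (2 * Real.pi * wt ((2 * Real.pi)⁻¹ • ξ) ^ (1 / 2 : ℝ)) ^ s := by gcongr
        _ = _ := by
          rw [Real.mul_rpow (by positivity) (Real.rpow_nonneg (wt_pos _).le _),
            ← Real.rpow_mul (wt_pos _).le]
          congr 2; ring
    calc _ ≤ ((2 * Real.pi) ^ s * wt ((2 * Real.pi)⁻¹ • ξ) ^ (s / 2)) *
          ((2 * Real.pi)⁻¹ * ‖(𝓕 (hu2.toLp u) : Lp ℂ 2 (volume : Measure Plane))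
            ((2 * Real.pi)⁻¹ • ξ)‖) := by gcongr
      _ = _ := by ring

lemma wt_rpow_le {γ s : ℝ} (h0 : 0 ≤ γ) (h2 : γ ≤ 2) (hs : 2 * γ ≤ s) (ξ : Plane) :
    wt ξ ^ γ ≤ 9 * (1 + |ξ 0| ^ s + |ξ 1| ^ s) := by
  obtain ⟨m, hm1, hm2, hm3⟩ : ∃ m : ℝ, 1 ≤ m ∧ wt ξ ≤ 3 * m ^ 2 ∧
      m ^ s ≤ 1 + |ξ 0| ^ s + |ξ 1| ^ s := by
    have p0 := Real.rpow_nonneg (abs_nonneg (ξ 0)) s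
    have p1 := Real.rpow_nonneg (abs_nonneg (ξ 1)) s
    refine ⟨max 1 (max |ξ 0| |ξ 1|), le_max_left _ _, ?_, ?_⟩
    · have a0 : (1 : ℝ) ≤ max 1 (max |ξ 0| |ξ 1|) := le_max_left _ _
      have a1 : |ξ 0| ≤ max 1 (max |ξ 0| |ξ 1|) := (le_max_left _ _).trans (le_max_right _ _)
      have a2 : |ξ 1| ≤ max 1 (max |ξ 0| |ξ 1|) := (le_max_right _ _).trans (le_max_right _ _)
      rw [wt_eq, ← sq_abs (ξ 0), ← sq_abs (ξ 1)]
      have b0 := pow_le_pow_left₀ zero_le_one a0 2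
      have b1 := pow_le_pow_left₀ (abs_nonneg _) a1 2
      have b2 := pow_le_pow_left₀ (abs_nonneg _) a2 2
      linarith
    · rcases max_choice 1 (max |ξ 0| |ξ 1|) with h | h
      · rw [h, Real.one_rpow]; linarith
      · rw [h]
        rcases max_choice |ξ 0| |ξ 1| with h' | h' <;> rw [h'] <;> linarith
  calc wt ξ ^ γ ≤ (3 * m ^ 2) ^ γ := Real.rpow_le_rpow (wt_pos ξ).le hm2 h0
    _ = 3 ^ γ * m ^ (2 * γ) := by
        rw [Real.mul_rpow (by norm_num) (by positivity), ← Real.rpow_natCast m 2,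
          ← Real.rpow_mul (by positivity)]
        norm_num
    _ ≤ 3 ^ (2 : ℝ) * m ^ s := by
        gcongr
        norm_num
    _ ≤ _ := by
        have : (3 : ℝ) ^ (2 : ℝ) = 9 := by norm_num
        rw [this]; gcongr

/-- The isotropic weight is dominated by the two axial ones: comparing both with a power of
`max 1 |ξ₀| |ξ₁| ≥ 1` and using `2γ ≤ s` gives a constant independent of `s`. -/
lemma wtMul_fourier_bound {γ s : ℝ} (h0 : 0 ≤ γ) (h2 : γ ≤ 2) (hs : 2 * γ ≤ s) {u : Plane → ℂ}
    (hu : MemH s u) :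
    MemLp (wtMul γ (fourier u)) 2 volume ∧
      norm2 (wtMul γ (fourier u)) ≤
        ENNReal.ofReal 9 * (norm2 u + norm2 (Dx s u) + norm2 (Dy s u)) := by
  have hs0 : 0 ≤ s := by linarith
  have hf := memLp_fourier u
  have hd0 := memLp_dirSymbol_mul_fourier hs0 hu 0
  have hd1 := memLp_dirSymbol_mul_fourier hs0 hu 1
  have hS := (hf.norm.add hd0.norm).add hd1.norm
  have hle : ∀ ξ, ‖wtMul γ (fourier u) ξ‖ ≤ 9 * ‖(((fun ξ => ‖fourier u ξ‖) +
      fun ξ => ‖dirSymbol 0 s ξ * fourier u ξ‖) +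
      fun ξ => ‖dirSymbol 1 s ξ * fourier u ξ‖) ξ‖ := by
    intro ξ
    simp only [Pi.add_apply]
    rw [Real.norm_of_nonneg (by positivity), wtMul, norm_mul, norm_mul, norm_mul, Complex.norm_real,
      dirSymbol, dirSymbol, Complex.norm_real, Complex.norm_real,
      Real.norm_of_nonneg (Real.rpow_nonneg (wt_pos ξ).le _),
      Real.norm_of_nonneg (by positivity), Real.norm_of_nonneg (by positivity)]
    calc _ ≤ 9 * (1 + |ξ 0| ^ s + |ξ 1| ^ s) * ‖fourier u ξ‖ := by
          gcongr; exact wt_rpow_le h0 h2 hs ξ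
      _ = _ := by ring
  have hm : AEStronglyMeasurable (wtMul γ (fourier u)) volume :=
    (Complex.measurable_ofReal.comp (measurable_wt.pow_const _)).aestronglyMeasurable.mul hf.1
  refine ⟨hS.of_le_mul hm (Eventually.of_forall hle), ?_⟩
  refine (eLpNorm_le_mul_eLpNorm_of_ae_le_mul (Eventually.of_forall hle) 2).trans ?_
  gcongr
  refine (eLpNorm_add_le (hf.norm.add hd0.norm).1 hd1.norm.1 one_le_two).trans ?_
  gcongr
  · refine (eLpNorm_add_le hf.norm.1 hd0.norm.1 one_le_two).trans ?_
    gcongr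
    · rw [eLpNorm_norm]
      exact (norm2_fourier hu.1).le
    · rw [eLpNorm_norm]
      exact (norm2_fourierInv hd0).ge
  · rw [eLpNorm_norm]
    exact (norm2_fourierInv hd1).ge

lemma memLp_weight_of_withDensity (j : Fin 2) (r : ℝ) {ρ : Plane → ℝ} (hρm : Measurable ρ)
    (hρ : ∀ p, |p j| ^ (2 * r) ≤ ρ p) {u : Plane → ℂ} (hu : MemLp u 2 volume)
    (h : MemLp u 2 ((volume : Measure Plane).withDensity fun p => ENNReal.ofReal (ρ p))) :
    MemLp (weight j r u) 2 volume := by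
  have hwm : Measurable fun p : Plane => ((|p j| ^ r : ℝ) : ℂ) := by fun_prop
  refine memLp_two_of_enorm_le (G := fun p => ‖weight j r u p‖ₑ)
    (hwm.aestronglyMeasurable.mul hu.1) ?_ (Eventually.of_forall fun _ => le_rfl)
  have h1 := lintegral_rpow_enorm_lt_top_of_eLpNorm_lt_top two_ne_zero ENNReal.ofNat_ne_top h.2
  simp only [ENNReal.toReal_ofNat, ENNReal.rpow_two] at h1
  rw [lintegral_withDensity_eq_lintegral_mul₀ hρm.ennreal_ofReal.aemeasurable
    (hu.1.enorm.pow_const 2)] at h1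
  refine lt_of_le_of_lt (lintegral_mono fun p => ?_) h1
  rw [Pi.mul_apply, weight, enorm_mul, mul_pow, ← ofReal_norm, Complex.norm_real,
    Real.norm_of_nonneg (by positivity), ← ENNReal.ofReal_pow (by positivity)]
  gcongr
  rw [← Real.rpow_natCast, ← Real.rpow_mul (abs_nonneg _), mul_comm]
  exact hρ p

/-! ### The formulas for `|x_j|^r W(t)` -/

/-- The formula for `|x_j|^α W(t) u` together with the bound of its remainder, in a scale of
weights on the frequency side; the exponent `β = 0` gives the unweighted bound. -/
lemma exists_weight_W {α β : ℝ} (hα : α < 1) (hβ0 : 0 ≤ β) (hβ : β < α) :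
    ∃ c : ℝ, 0 < c ∧ ∀ (j : Fin 2) (s : ℝ) (u : Plane → ℂ) (t : ℝ), 2 * α + β ≤ s → MemH s u →
      MemLp (weight j α u) 2 volume →
        (PhiDefined j t α (fourier u) ∧ MemLp (Phi j t α (fourier u)) 2 volume) ∧
        weight j α (W t u) =ᵐ[volume]
          W t (weight j α u) + W t (fourierInv (Phi j t α (fourier u))) ∧
        MemLp (wtMul (β / 2) (Phi j t α (fourier u))) 2 volume ∧
        norm2 (wtMul (β / 2) (Phi j t α (fourier u))) ≤
          ENNReal.ofReal (c * (1 + |t|)) * (norm2 u + norm2 (Dx s u) + norm2 (Dy s u)) := by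
  have hα0 : 0 < α := hβ0.trans_lt hβ
  obtain ⟨c, hc, hb⟩ := exists_norm2_wtMul_Phi_le hα hβ0 hβ
  obtain ⟨c', _, hb'⟩ := exists_norm2_wtMul_Phi_le hα le_rfl hα0
  refine ⟨c * 9, by positivity, fun j s u t hs hu hw => ?_⟩
  have hfm := measurable_fourier u
  obtain ⟨m1, -⟩ := wtMul_fourier_bound (γ := α) hα0.le (by linarith) (by linarith) hu
  obtain ⟨m2, n2⟩ := wtMul_fourier_bound (γ := α + β / 2) (s := s) (by positivity) (by linarith)
    (by linarith) hu
  have hM := lintegral_phiMajorant_sq_lt_top hα0 hα j hfm m1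
  have hΦ : MemLp (Phi j t α (fourier u)) 2 volume := by
    have := (hb' j t (fourier u) hfm (by simpa using m1)).1
    refine (memLp_congr_ae (Eventually.of_forall fun ζ => ?_)).1 this
    simp [wtMul]
  obtain ⟨b1, b2⟩ := hb j t (fourier u) hfm m2
  refine ⟨⟨phiDefined_of_ae_lt_top j t α hfm (ae_phiMajorant_lt_top hfm hM), hΦ⟩,
    weight_W j t hα0 hα hu.1 hw hM hΦ, b1, b2.trans ?_⟩
  calc _ ≤ ENNReal.ofReal (c * (1 + |t|)) *
        (ENNReal.ofReal 9 * (norm2 u + norm2 (Dx s u) + norm2 (Dy s u))) := by gcongr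
    _ = _ := by
      rw [← mul_assoc, ← ENNReal.ofReal_mul (by positivity)]
      congr 2; ring

lemma norm_homSymbol_mul_le {β : ℝ} (hβ : 0 ≤ β) (g : Plane → ℂ) (ζ : Plane) :
    ‖homSymbol β ζ * g ζ‖ ≤ ‖wtMul (β / 2) g ζ‖ := by
  rw [homSymbol, wtMul, norm_mul, norm_mul, Complex.norm_real, Complex.norm_real,
    Real.norm_of_nonneg (by positivity), Real.norm_of_nonneg (Real.rpow_nonneg (wt_pos ζ).le _)]
  gcongr
  calc ‖ζ‖ ^ β = (‖ζ‖ ^ 2) ^ (β / 2) := by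
        rw [← Real.rpow_natCast, ← Real.rpow_mul (norm_nonneg _)]; congr 1; push_cast; ring
    _ ≤ wt ζ ^ (β / 2) := by
        gcongr
        unfold wt; linarith

lemma measurable_homSymbol (β : ℝ) : Measurable (homSymbol β) := by
  unfold homSymbol; fun_prop

lemma memLp_homSymbol_mul {β : ℝ} (hβ : 0 ≤ β) {g : Plane → ℂ} (hg : MemLp g 2 volume)
    (hw : MemLp (wtMul (β / 2) g) 2 volume) :
    MemLp (fun ζ => homSymbol β ζ * g ζ) 2 volume :=
  hw.of_le ((measurable_homSymbol β).aestronglyMeasurable.mul hg.1)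
    (Eventually.of_forall (norm_homSymbol_mul_le hβ g))

lemma D_fourierInv (β : ℝ) {g : Plane → ℂ} (hg : MemLp g 2 volume) :
    D β (fourierInv g) = fourierInv fun ζ => homSymbol β ζ * g ζ := by
  refine fourierInv_congr ?_
  filter_upwards [fourier_fourierInv hg] with ζ hζ
  rw [hζ]

lemma norm2_D_fourierInv_le {β : ℝ} (hβ : 0 ≤ β) {g : Plane → ℂ} (hg : MemLp g 2 volume)
    (hw : MemLp (wtMul (β / 2) g) 2 volume) :
    norm2 (D β (fourierInv g)) ≤ norm2 (wtMul (β / 2) g) := by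
  rw [D_fourierInv β hg, norm2_fourierInv (memLp_homSymbol_mul hβ hg hw)]
  exact eLpNorm_mono (norm_homSymbol_mul_le hβ g)

lemma multiplierMemL2_fourierInv {m : Plane → ℂ} {g : Plane → ℂ} (hg : MemLp g 2 volume)
    (h : MemLp (fun ζ => m ζ * g ζ) 2 volume) : MultiplierMemL2 m (fourierInv g) := by
  refine ⟨memLp_fourierInv g, (memLp_congr_ae ?_).2 h⟩
  filter_upwards [fourier_fourierInv hg] with ζ hζ
  rw [hζ]

/-- Fourier multipliers commute with `W t`, so they may be applied to an identity
`v = W t a + W t b` term by term. -/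
lemma multiplier_eq_of_eq_W_add {m : Plane → ℂ} {t : ℝ} {v a b : Plane → ℂ}
    (h : v =ᵐ[volume] W t a + W t b) (ha : MultiplierMemL2 m a) (hb : MultiplierMemL2 m b) :
    MultiplierMemL2 m v ∧
      multiplier m v =ᵐ[volume] W t (multiplier m a) + W t (multiplier m b) := by
  have e : (fun ζ => m ζ * fourier v ζ) =ᵐ[volume]
      (fun ζ => grp t ζ * (m ζ * fourier a ζ)) + fun ζ => grp t ζ * (m ζ * fourier b ζ) := by
    rw [fourier_congr h]
    filter_upwards [fourier_add (memLp_W t a) (memLp_W t b), fourier_W t a, fourier_W t b]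
      with ζ h1 h2 h3
    rw [h1, Pi.add_apply, Pi.add_apply, h2, h3]
    ring
  have ia := memLp_grp_mul (t := t) ha.2
  have ib := memLp_grp_mul (t := t) hb.2
  refine ⟨⟨(memLp_congr_ae h).2 ((memLp_W t a).add (memLp_W t b)),
    (memLp_congr_ae e).2 (ia.add ib)⟩, ?_⟩
  rw [multiplier, fourierInv_congr e, multiplier, multiplier, W_fourierInv t ha.2,
    W_fourierInv t hb.2]
  exact fourierInv_add ia ib

lemma memLp_weight_of_memZ {s r₁ r₂ : ℝ} {u : Plane → ℂ} (h : MemZ s r₁ r₂ u) :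
    MemLp (weight 0 r₁ u) 2 volume ∧ MemLp (weight 1 r₂ u) 2 volume := by
  obtain ⟨⟨hu, -⟩, hd⟩ := h
  have hm : Measurable fun p : Plane => |p 0| ^ (2 * r₁) + |p 1| ^ (2 * r₂) := by fun_prop
  exact ⟨memLp_weight_of_withDensity 0 r₁ hm
      (fun p => le_add_of_nonneg_right (by positivity)) hu hd,
    memLp_weight_of_withDensity 1 r₂ hm
      (fun p => le_add_of_nonneg_left (by positivity)) hu hd⟩

end ZK

theorem theorem2 (r₁ r₂ : ℝ) (hr₁ : r₁ ∈ Set.Ioo (0 : ℝ) 1) (hr₂ : r₂ ∈ Set.Ioo (0 : ℝ) 1) :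
    (∃ c : ℝ, 0 < c ∧ ∀ s : ℝ, 2 * max r₁ r₂ ≤ s →
      ∀ u₀ : Plane → ℂ, MemZ s r₁ r₂ u₀ → ∀ t : ℝ,
        -- the functions Φ₁, Φ₂ exist almost everywhere and belong to L²
        (PhiDefined 0 t r₁ (fourier u₀) ∧ MemLp (Phi 0 t r₁ (fourier u₀)) 2 volume) ∧
        (PhiDefined 1 t r₂ (fourier u₀) ∧ MemLp (Phi 1 t r₂ (fourier u₀)) 2 volume) ∧
        -- the formula with |x|^r₁, and its remainder
        weight 0 r₁ (W t u₀) =ᵐ[volume]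
          W t (weight 0 r₁ u₀) + W t (fourierInv (Phi 0 t r₁ (fourier u₀))) ∧
        norm2 (fourierInv (Phi 0 t r₁ (fourier u₀))) ≤
          ENNReal.ofReal (c * (1 + |t|)) * (norm2 u₀ + norm2 (Dx s u₀) + norm2 (Dy s u₀)) ∧
        -- the formula with |y|^r₂, and its remainder
        weight 1 r₂ (W t u₀) =ᵐ[volume]
          W t (weight 1 r₂ u₀) + W t (fourierInv (Phi 1 t r₂ (fourier u₀))) ∧
        norm2 (fourierInv (Phi 1 t r₂ (fourier u₀))) ≤
          ENNReal.ofReal (c * (1 + |t|)) * (norm2 u₀ + norm2 (Dx s u₀) + norm2 (Dy s u₀))) ∧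
    (∀ β ∈ Set.Ioo (0 : ℝ) (min r₁ r₂),
      ∃ c : ℝ, 0 < c ∧ ∀ s : ℝ, 2 * max r₁ r₂ ≤ s →
      ∀ u₀ : Plane → ℂ, MemZ s r₁ r₂ u₀ →
        MultiplierMemL2 (homSymbol β) (weight 0 r₁ u₀) →
        MultiplierMemL2 (homSymbol β) (weight 1 r₂ u₀) →
        MemH (β + s) u₀ → ∀ t : ℝ,
        -- every term to which D^β is applied lies in its domain
        (MultiplierMemL2 (homSymbol β) (weight 0 r₁ (W t u₀)) ∧
          MultiplierMemL2 (homSymbol β) (fourierInv (Phi 0 t r₁ (fourier u₀)))) ∧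
        (MultiplierMemL2 (homSymbol β) (weight 1 r₂ (W t u₀)) ∧
          MultiplierMemL2 (homSymbol β) (fourierInv (Phi 1 t r₂ (fourier u₀)))) ∧
        -- the formula with D^β |x|^r₁, and its remainder
        D β (weight 0 r₁ (W t u₀)) =ᵐ[volume]
          W t (D β (weight 0 r₁ u₀)) + W t (D β (fourierInv (Phi 0 t r₁ (fourier u₀)))) ∧
        norm2 (D β (fourierInv (Phi 0 t r₁ (fourier u₀)))) ≤
          ENNReal.ofReal (c * (1 + |t|)) *
            (norm2 u₀ + norm2 (Dx (β + s) u₀) + norm2 (Dy (β + s) u₀)) ∧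
        -- the formula with D^β |y|^r₂, and its remainder
        D β (weight 1 r₂ (W t u₀)) =ᵐ[volume]
          W t (D β (weight 1 r₂ u₀)) + W t (D β (fourierInv (Phi 1 t r₂ (fourier u₀)))) ∧
        norm2 (D β (fourierInv (Phi 1 t r₂ (fourier u₀)))) ≤
          ENNReal.ofReal (c * (1 + |t|)) *
            (norm2 u₀ + norm2 (Dx (β + s) u₀) + norm2 (Dy (β + s) u₀))) := by
  have hw0 : ∀ g : Plane → ℂ, wtMul (0 / 2) g = g := fun g => by ext ζ; simp [wtMul]
  have hmono : ∀ {a b t : ℝ} {X Y : ℝ≥0∞}, a ≤ b → X ≤ ENNReal.ofReal (a * (1 + |t|)) * Y →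
      X ≤ ENNReal.ofReal (b * (1 + |t|)) * Y := by
    intro a b t X Y hab h
    refine h.trans ?_
    gcongr
  constructor
  · obtain ⟨c₁, hc₁, h₁⟩ := exists_weight_W hr₁.2 le_rfl hr₁.1
    obtain ⟨c₂, hc₂, h₂⟩ := exists_weight_W hr₂.2 le_rfl hr₂.1
    refine ⟨c₁ + c₂, by positivity, fun s hs u₀ hZ t => ?_⟩
    obtain ⟨hwt₁, hwt₂⟩ := memLp_weight_of_memZ hZ
    have hs₁ : 2 * r₁ + 0 ≤ s := by linarith [le_max_left r₁ r₂]
    have hs₂ : 2 * r₂ + 0 ≤ s := by linarith [le_max_right r₁ r₂]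
    obtain ⟨p₁, f₁, -, b₁⟩ := h₁ 0 s u₀ t hs₁ hZ.1 hwt₁
    obtain ⟨p₂, f₂, -, b₂⟩ := h₂ 1 s u₀ t hs₂ hZ.1 hwt₂
    rw [hw0, ← norm2_fourierInv p₁.2] at b₁
    rw [hw0, ← norm2_fourierInv p₂.2] at b₂
    exact ⟨p₁, p₂, f₁, hmono (by linarith) b₁, f₂, hmono (by linarith) b₂⟩
  · intro β hβ
    have hβ₁ : β < r₁ := hβ.2.trans_le (min_le_left _ _)
    have hβ₂ : β < r₂ := hβ.2.trans_le (min_le_right _ _)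
    obtain ⟨c₁, hc₁, h₁⟩ := exists_weight_W hr₁.2 hβ.1.le hβ₁
    obtain ⟨c₂, hc₂, h₂⟩ := exists_weight_W hr₂.2 hβ.1.le hβ₂
    refine ⟨c₁ + c₂, by positivity, fun s hs u₀ hZ hD₁ hD₂ hH t => ?_⟩
    obtain ⟨hwt₁, hwt₂⟩ := memLp_weight_of_memZ hZ
    have hs₁ : 2 * r₁ + β ≤ β + s := by linarith [le_max_left r₁ r₂]
    have hs₂ : 2 * r₂ + β ≤ β + s := by linarith [le_max_right r₁ r₂]
    obtain ⟨p₁, f₁, m₁, b₁⟩ := h₁ 0 (β + s) u₀ t hs₁ hH hwt₁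
    obtain ⟨p₂, f₂, m₂, b₂⟩ := h₂ 1 (β + s) u₀ t hs₂ hH hwt₂
    have d₁ := multiplierMemL2_fourierInv p₁.2 (memLp_homSymbol_mul hβ.1.le p₁.2 m₁)
    have d₂ := multiplierMemL2_fourierInv p₂.2 (memLp_homSymbol_mul hβ.1.le p₂.2 m₂)
    obtain ⟨v₁, e₁⟩ := multiplier_eq_of_eq_W_add f₁ hD₁ d₁
    obtain ⟨v₂, e₂⟩ := multiplier_eq_of_eq_W_add f₂ hD₂ d₂
    exact ⟨⟨v₁, d₁⟩, ⟨v₂, d₂⟩,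
      e₁, hmono (by linarith) ((norm2_D_fourierInv_le hβ.1.le p₁.2 m₁).trans b₁),
      e₂, hmono (by linarith) ((norm2_D_fourierInv_le hβ.1.le p₂.2 m₂).trans b₂)⟩
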